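/- Let $n\ge 1$ and let $\Omega\subset\mathbb R^n$ be a bounded open set (for instance a bounded convex domain of class $C^2$). There is a function $\lambda\mapsto C(\lambda)$, depending only on $n$ and $\Omega$, with the following property. Let $T>0$, $\Omega_T=\Omega\times(0,T)$, and let $a$ be a uniformly elliptic field of symmetric $n\times n$ matrices with entries in $L^\infty(\Omega_T)$, given up to time $t=0$ with $a(\cdot,0)\in L^\infty(\Omega)$. Put $$\lambda_{\min}(a)=\inf_{(x,t)\in\Omega_T}\ \inf_{|l|=1} l\cdot a(x,t)\,l,\qquad a[v,w](t)=\int_\Omega \nabla v(x,t)\cdot a(x,t)\nabla w(x,t)\,dx .$$ Let $F=(F_1,\dots,F_n)\in C([0,T];L^2(\Omega)^n)\cap L^2(0,T;H^1(\Omega)^n)$ be the weak solution of $$\partial_t F=\operatorname{div}(a\nabla F)\ \text{in }\Omega_T,\qquad F(x,t)=x\ \text{on }\partial\Omega\times(0,T),\qquad \operatorname{div}(a(x,0)\nabla F(x,0))=0\ \text{in }\Omega,$$ with $F(x,0)=x$ on $\partial\Omega$. Let $X_h$ be a finite-dimensional subspace of $H^1_0(\Omega)\cap W^{1,\infty}(\Omega)$,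 whose elements are Lipschitz functions on $\mathbb R^n$ vanishing outside $\Omega$, let $(\varphi_i)$ be a basis of $X_h$, let $M\ge 1$ be an integer, $t_k=kT/M$ for $0\le k\le M$, and let $g\in L^2(\Omega_T)$. Let $$v(x,t)=\sum_i c_i(t)\,\varphi_i(F(x,t))\in L^2(0,T;H^1_0(\Omega)),\qquad c_i \text{ constant on each } (t_k,t_{k+1}],\qquad v(\cdot,0)=0,$$ and put $v_k(x,t)=\sum_i c_i(t_k)\varphi_i(F(x,t))$. Suppose that $v$ solves the implicit scheme: for all $0\le k\le M-1$ and all $\psi(x,t)=\sum_i d_i\varphi_i(F(x,t))$ with constants $d_i\in\mathbb R$, $$(\psi(t_{k+1}),v_{k+1}(t_{k+1}))_{L^2(\Omega)}=(\psi(t_k),v_k(t_k))_{L^2(\Omega)}+\int_{t_k}^{t_{k+1}}\Big((\partial_t\psi(t),v_{k+1}(t))-a[\psi(t),v_{k+1}(t)]+(\psi(t),g(t))_{L^2(\Omega)}\Big)dt ,$$ where $\partial_t\psi=f_0-\operatorname{div}f$ is the weak time derivative of $\psi$, supposed to exist with $f_0\in L^1(\Omega_T)$ and $f\in L^2(\Omega_T)^n$,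 and $(\partial_t\psi,w)=\int_\Omega (f_0w+f\cdot\nabla w)\,dx$. Then $$\|v(T)\|_{L^2(\Omega)}+\|v\|_{L^2(0,T;H^1_0(\Omega))}\le C(\lambda_{\min}(a))\,\|g\|_{L^2(\Omega_T)},$$ where $\|w\|_{H^1_0(\Omega)}^2=\|w\|_{L^2(\Omega)}^2+\|\nabla w\|_{L^2(\Omega)}^2$. -/

import Mathlib

open MeasureTheory Set Filter Topology
open scoped ENNReal NNReal ContDiff

/-- Euclidean space `ℝⁿ`. -/
abbrev Eucl (n : ℕ) : Type := EuclideanSpace ℝ (Fin n)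

/-- Lebesgue measure on the space-time cylinder `Ω_T = Ω × (0,T)`; points are written `(t, x)`. -/
noncomputable def cylMeasure {n : ℕ} (Ω : Set (Eucl n)) (T : ℝ) : Measure (ℝ × Eucl n) :=
  (volume.restrict (Ioo 0 T)).prod (volume.restrict Ω)

/-! ### Sobolev spaces -/

/-- Test functions: the space `C_c^∞(Ω)`. -/
def IsTestFun {n : ℕ} (Ω : Set (Eucl n)) (η : Eucl n → ℝ) : Prop :=
  ContDiff ℝ ∞ η ∧ HasCompactSupport η ∧ tsupport η ⊆ Ω

/-- `G` is the weak (distributional) gradient of `u` in `Ω`. -/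
def HasWeakGrad {n : ℕ} (Ω : Set (Eucl n)) (u : Eucl n → ℝ) (G : Eucl n → Eucl n) : Prop :=
  LocallyIntegrableOn u Ω ∧ LocallyIntegrableOn G Ω ∧
    ∀ η : Eucl n → ℝ, IsTestFun Ω η → ∀ e : Eucl n,
      ∫ x in Ω, u x * fderiv ℝ η x e = - ∫ x in Ω, inner ℝ (G x) e * η x

open scoped Classical in
/-- The weak gradient of `u` in `Ω` (unique up to null sets; zero if there is none). -/
noncomputable def weakGrad {n : ℕ} (Ω : Set (Eucl n)) (u : Eucl n → ℝ) : Eucl n → Eucl n :=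
  if h : ∃ G, HasWeakGrad Ω u G then h.choose else 0

/-- `u ∈ H¹₀(Ω)`: `u` and its weak gradient are in `L²(Ω)`, and `u` is the limit in the `H¹`-norm
of functions of `C_c^∞(Ω)`. -/
def MemH10 {n : ℕ} (Ω : Set (Eucl n)) (u : Eucl n → ℝ) : Prop :=
  MemLp u 2 (volume.restrict Ω) ∧
    ∃ G : Eucl n → Eucl n, MemLp G 2 (volume.restrict Ω) ∧ HasWeakGrad Ω u G ∧
      ∃ η : ℕ → Eucl n → ℝ, (∀ k, IsTestFun Ω (η k)) ∧
        Tendsto (fun k => eLpNorm (fun x => u x - η k x) 2 (volume.restrict Ω)) atTop (𝓝 0) ∧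
        Tendsto (fun k => eLpNorm (fun x => G x - gradient (η k) x) 2 (volume.restrict Ω))
          atTop (𝓝 0)

/-- The norm of `H¹₀(Ω)`, `(‖u‖²_{L²} + ‖∇u‖²_{L²})^{1/2}`. -/
noncomputable def h1Norm {n : ℕ} (Ω : Set (Eucl n)) (u : Eucl n → ℝ) : ℝ≥0∞ :=
  (eLpNorm u 2 (volume.restrict Ω) ^ 2 +
    eLpNorm (weakGrad Ω u) 2 (volume.restrict Ω) ^ 2) ^ (1 / 2 : ℝ)

/-- `u ∈ L²(0,T;H¹₀(Ω))`. -/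
def MemL2H10 {n : ℕ} (Ω : Set (Eucl n)) (T : ℝ) (u : ℝ → Eucl n → ℝ) : Prop :=
  MemLp (fun p : ℝ × Eucl n => u p.1 p.2) 2 (cylMeasure Ω T) ∧
    ∃ G : ℝ → Eucl n → Eucl n,
      MemLp (fun p : ℝ × Eucl n => G p.1 p.2) 2 (cylMeasure Ω T) ∧
      ∀ᵐ t ∂(volume.restrict (Ioo 0 T)), MemH10 Ω (u t) ∧ HasWeakGrad Ω (u t) (G t)

/-- The norm of `L²(0,T;H¹₀(Ω))`. -/
noncomputable def l2H1Norm {n : ℕ} (Ω : Set (Eucl n)) (T : ℝ) (u : ℝ → Eucl n → ℝ) : ℝ≥0∞ :=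
  (∫⁻ t in Ioo 0 T, h1Norm Ω (u t) ^ 2) ^ (1 / 2 : ℝ)

/-- The duality pairing of the functional `f₀ - div f` with `w`. If `f₀` and `div f` are square
integrable and `w ∈ H¹₀(Ω)`, this is the scalar product of `f₀ - div f` and `w` in `L²(Ω)`. -/
noncomputable def pairing {n : ℕ} (Ω : Set (Eucl n)) (f₀ : Eucl n → ℝ) (f : Eucl n → Eucl n)
    (w : Eucl n → ℝ) : ℝ :=
  ∫ x in Ω, (f₀ x * w x + inner ℝ (f x) (weakGrad Ω w x))

/-- `∂ₜ u = f₀ - div f` weakly on `Ω × (0,T)`, with `f₀ ∈ L¹(Ω_T)` and `f ∈ L²(Ω_T)ⁿ`; that is,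
`∂ₜ u ∈ L¹(Ω_T) + L²(0,T;H⁻¹(Ω))`, a space which contains `L²(Ω_T)` and `L²(0,T;H⁻¹(Ω))`.
The values `u t` are those of the continuous representative. -/
structure HasWeakTimeDeriv {n : ℕ} (Ω : Set (Eucl n)) (T : ℝ) (u f₀ : ℝ → Eucl n → ℝ)
    (f : ℝ → Eucl n → Eucl n) : Prop where
  integrable : Integrable (fun p : ℝ × Eucl n => f₀ p.1 p.2) (cylMeasure Ω T)
  memLp : MemLp (fun p : ℝ × Eucl n => f p.1 p.2) 2 (cylMeasure Ω T)
  eq : ∀ w : Eucl n → ℝ, MemH10 Ω w → MemLp w ∞ (volume.restrict Ω) →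
    ∀ s t : ℝ, 0 ≤ s → s ≤ t → t ≤ T →
      (∫ x in Ω, u t x * w x) - (∫ x in Ω, u s x * w x)
        = ∫ r in s..t, pairing Ω (f₀ r) (f r) w

/-! ### The coefficient matrix and the harmonic coordinates -/

/-- `a` is a symmetric, uniformly elliptic matrix field with entries in `L^∞(Ω_T)`; it is given up
to the initial time, where its entries are in `L^∞(Ω)`. -/
structure IsCoefficient {n : ℕ} (Ω : Set (Eucl n)) (T : ℝ)
    (a : ℝ → Eucl n → Matrix (Fin n) (Fin n) ℝ) : Prop where
  symm : ∀ t ∈ Icc 0 T, ∀ x ∈ Ω, (a t x).IsSymm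
  elliptic : ∃ lam : ℝ, 0 < lam ∧ ∀ t ∈ Icc 0 T, ∀ x ∈ Ω, ∀ l : Eucl n,
    lam * ‖l‖ ^ 2 ≤ inner ℝ l ((a t x).toEuclideanLin l)
  bounded : ∀ i j, MemLp (fun p : ℝ × Eucl n => a p.1 p.2 i j) ∞ (cylMeasure Ω T)
  bounded_init : ∀ i j, MemLp (fun x => a 0 x i j) ∞ (volume.restrict Ω)

/-- `λ_min(a) = inf_{(x,t) ∈ Ω_T} inf_{|l| = 1} l · a(x,t) l`. -/
noncomputable def lambdaMin {n : ℕ} (Ω : Set (Eucl n)) (T : ℝ)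
    (a : ℝ → Eucl n → Matrix (Fin n) (Fin n) ℝ) : ℝ :=
  sInf {r : ℝ | ∃ t ∈ Ioo 0 T, ∃ x ∈ Ω, ∃ l : Eucl n, ‖l‖ = 1 ∧
    r = inner ℝ l ((a t x).toEuclideanLin l)}

/-- The bilinear form `a[v,w] = ∫_Ω ᵗ∇v A ∇w` of a matrix field `A` on `Ω`. -/
noncomputable def aForm {n : ℕ} (Ω : Set (Eucl n)) (A : Eucl n → Matrix (Fin n) (Fin n) ℝ)
    (v w : Eucl n → ℝ) : ℝ :=
  ∫ x in Ω, inner ℝ (weakGrad Ω v x) ((A x).toEuclideanLin (weakGrad Ω w x))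

/-- `F` is the (weak) solution, in `C([0,T];L²(Ω)) ∩ L²(0,T;H¹(Ω))`, of `∂ₜ F = div (a ∇F)` in
`Ω_T`, `F(x,t) = x` on `∂Ω × (0,T)`, where the initial value `F(·,0)` is the solution of
`div (a(·,0) ∇F(·,0)) = 0` in `Ω`, `F(x,0) = x` on `∂Ω`. -/
structure IsHarmonicCoord {n : ℕ} (Ω : Set (Eucl n)) (T : ℝ)
    (a : ℝ → Eucl n → Matrix (Fin n) (Fin n) ℝ) (F : ℝ → Eucl n → Eucl n) : Prop where
  memLp : ∀ t ∈ Icc 0 T, MemLp (F t) 2 (volume.restrict Ω)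
  continuous : ∀ t ∈ Icc 0 T,
    Tendsto (fun s => eLpNorm (fun x => F s x - F t x) 2 (volume.restrict Ω))
      (𝓝[Icc 0 T] t) (𝓝 0)
  boundary : ∀ i, MemL2H10 Ω T (fun t x => F t x i - x i)
  equation : ∀ i, ∃ G : ℝ → Eucl n → Eucl n,
    MemLp (fun p : ℝ × Eucl n => G p.1 p.2) 2 (cylMeasure Ω T) ∧
    (∀ᵐ t ∂(volume.restrict (Ioo 0 T)), HasWeakGrad Ω (fun x => F t x i) (G t)) ∧
    HasWeakTimeDeriv Ω T (fun t x => F t x i) 0 (fun t x => -(a t x).toEuclideanLin (G t x))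
  boundary_init : ∀ i, MemH10 Ω (fun x => F 0 x i - x i)
  equation_init : ∀ i, ∀ w, MemH10 Ω w → aForm Ω (a 0) w (fun x => F 0 x i) = 0

/-! ### The discrete spaces and the implicit scheme -/

/-- `φ ∈ H¹₀(Ω) ∩ W^{1,∞}(Ω)`, represented by its Lipschitz extension by zero. -/
def IsElement {n : ℕ} (Ω : Set (Eucl n)) (φ : Eucl n → ℝ) : Prop :=
  MemH10 Ω φ ∧ (∃ K : ℝ≥0, LipschitzWith K φ) ∧ ∀ x, x ∉ Ω → φ x = 0

/-- The function `(x,t) ↦ ∑ᵢ cᵢ(t) φᵢ(F(x,t))`. -/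
noncomputable def comb {n N : ℕ} (φ : Fin N → Eucl n → ℝ) (F : ℝ → Eucl n → Eucl n)
    (c : ℝ → Fin N → ℝ) : ℝ → Eucl n → ℝ :=
  fun t x => ∑ i, c t i * φ i (F t x)

/-- The time `t_k = k T / M`. -/
noncomputable def gridTime (T : ℝ) (M k : ℕ) : ℝ := k * (T / M)

/-- The function with coefficients `c` belongs to the space `Z_T`: it is in `L²(0,T;H¹₀(Ω))` and
its coefficients are constant on each interval `(t_k, t_{k+1}]`. -/
def MemZ {n N : ℕ} (Ω : Set (Eucl n)) (T : ℝ) (M : ℕ) (φ : Fin N → Eucl n → ℝ)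
    (F : ℝ → Eucl n → Eucl n) (c : ℝ → Fin N → ℝ) : Prop :=
  MemL2H10 Ω T (comb φ F c) ∧
    ∀ k < M, ∀ t ∈ Ioc (gridTime T M k) (gridTime T M (k + 1)), c t = c (gridTime T M (k + 1))

/-- `v = ∑ᵢ cᵢ(t) φᵢ(F(x,t)) ∈ Z_T` solves the implicit scheme: `v(·,0) = 0` and, for all
`ψ = ∑ᵢ dᵢ φᵢ(F(x,t))` with constant coefficients and all `0 ≤ k < M`,
`(ψ(t_{k+1}), v_{k+1}(t_{k+1})) = (ψ(t_k), v_k(t_k))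
  + ∫_{t_k}^{t_{k+1}} ((∂ₜψ, v_{k+1}) - a[ψ, v_{k+1}] + (ψ, g)) dt`,
where `v_k = ∑ᵢ cᵢ(t_k) φᵢ(F(x,t))` and `∂ₜψ = f₀ - div f` is the weak time derivative of `ψ`. -/
def SolvesScheme {n N : ℕ} (Ω : Set (Eucl n)) (T : ℝ) (M : ℕ)
    (a : ℝ → Eucl n → Matrix (Fin n) (Fin n) ℝ) (g : ℝ → Eucl n → ℝ)
    (φ : Fin N → Eucl n → ℝ) (F : ℝ → Eucl n → Eucl n) (c : ℝ → Fin N → ℝ) : Prop :=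
  MemZ Ω T M φ F c ∧
  (∀ᵐ x ∂(volume.restrict Ω), comb φ F c 0 x = 0) ∧
  ∀ d : Fin N → ℝ, ∃ (f₀ : ℝ → Eucl n → ℝ) (f : ℝ → Eucl n → Eucl n),
    HasWeakTimeDeriv Ω T (comb φ F (fun _ => d)) f₀ f ∧
    ∀ k < M,
      let ψ := comb φ F (fun _ => d)
      let v : ℕ → ℝ → Eucl n → ℝ := fun m => comb φ F (fun _ => c (gridTime T M m))
      let s := gridTime T M k
      let s' := gridTime T M (k + 1)
      ∫ x in Ω, ψ s' x * v (k + 1) s' x =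
        (∫ x in Ω, ψ s x * v k s x) +
          ∫ t in s..s', (pairing Ω (f₀ t) (f t) (v (k + 1) t)
            - aForm Ω (a t) (ψ t) (v (k + 1) t)
            + ∫ x in Ω, ψ t x * g t x)

/-!
The scheme on `(t_k, t_{k+1}]` may be tested with its own solution there, `w = v_{k+1}`, since the
coefficients of `v` are constant on that interval. Given the energy identity
`∫ (∂ₜw, w) dt = (‖w(t_{k+1})‖² - ‖w(t_k)‖²) / 2` (`energy_identity`), the scheme becomes
`‖v_{k+1}(t_{k+1})‖² + ‖w(t_k)‖² + 2 ∫ a[w, w] dt = 2 (w(t_k), v_k(t_k)) + 2 ∫ (w, g) dt`, and the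
inequality `2 (w, v_k) ≤ ‖w‖² + ‖v_k‖²` at time `t_k` removes the unknown `w(t_k)` (`energy_step`).
The sum over `k` telescopes: with `λ = λ_min(a)`,
`‖v(T)‖² + 2 λ ‖∇v‖² ≤ 2 ∫ v g ≤ 2 ‖v‖ ‖g‖` (`energy_inequality`). The Poincaré inequality
`‖v‖ ≤ P ‖∇v‖` (`MemH10.poincare`) gives the bounds of `‖∇v‖` and `‖v(T)‖` by `‖g‖`
(`bounds_of_energy`), with a constant that depends on `λ` and on the radius of a ball
containing `Ω`.

The energy identity is the analytic point, because `∂ₜw` is only in `L¹(Ω_T) + L²(0,T;H⁻¹(Ω))`. It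
holds because `w` is bounded and lies in `L²(0,T;H¹₀(Ω))`. For almost every `r`, the equation on
`(r, r+h)` can be tested with the functions `w(r)` and `w(r+h)` of `H¹₀(Ω) ∩ L^∞(Ω)`, and the sum of
the results is `‖w(r+h)‖² - ‖w(r)‖²`. Integrated in `r` and divided by `h`, the left-hand sides are
averages of pairings of translates in time, for the exponents `(2, 2)` and `(1, ∞)`; they converge
as `h → 0` by the continuity of translations in `L²` and in `L¹`
(`tendsto_average_inner_translate`). Of the coordinates `F`, only their continuity in `L²` is used,
which makes `t ↦ ‖w(t)‖²` continuous.
-/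

/-! ### Continuity of translations and averaged pairings -/

section Translation

variable {Z : Type*} [NormedAddCommGroup Z] [NormedSpace ℝ Z] [FiniteDimensional ℝ Z]
  [MeasurableSpace Z] [BorelSpace Z] {μ : Measure Z} [μ.IsAddHaarMeasure]

theorem tendsto_eLpNorm_translate_sub {V : Type*} [NormedAddCommGroup V] {p : ℝ≥0∞}
    (hp1 : 1 ≤ p) (hp : p ≠ ⊤) {f : Z → V} (hf : MemLp f p μ) :
    Tendsto (fun w : Z => eLpNorm (fun z => f (z + w) - f z) p μ) (𝓝 0) (𝓝 0) := by
  have : Fact (1 ≤ p) := ⟨hp1⟩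
  have : ProperSpace Z := FiniteDimensional.proper ℝ Z
  let G : C(Z, C(Z, Z)) := ContinuousMap.curry ⟨fun q : Z × Z => q.2 + q.1, by fun_prop⟩
  have hG : ∀ w, MeasurePreserving (G w) μ μ := fun w => measurePreserving_add_right μ w
  have hc := (continuous_const (y := hf.toLp f)).compMeasurePreservingLp G.continuous hG hp
  have h0 := hc.tendsto 0
  have hm : ∀ w, MemLp (f ∘ G w) p μ := fun w => hf.comp_measurePreserving (hG w)
  simp only [Lp.toLp_compMeasurePreserving hf (hG _)] at h0
  rw [Lp.tendsto_Lp_iff_tendsto_eLpNorm'' _ hm] at h0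
  refine h0.congr fun w => ?_
  congr 1
  ext z
  simp [G]

variable {V : Type*} [NormedAddCommGroup V] [InnerProductSpace ℝ V]

theorem integrable_inner_of_memLp {α : Type*} [MeasurableSpace α] {ν : Measure α} {p q : ℝ≥0∞}
    [ENNReal.HolderTriple p q 1] {f g : α → V} (hf : MemLp f p ν) (hg : MemLp g q ν) :
    Integrable (fun z => inner ℝ (f z) (g z)) ν := by
  rw [← memLp_one_iff_integrable]
  refine hf.of_bilin (fun a b => inner ℝ a b) 1 hg (hf.1.inner hg.1) (.of_forall fun z => ?_)
  simpa using nnnorm_inner_le_nnnorm (𝕜 := ℝ) (f z) (g z)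

theorem abs_integral_inner_le {α : Type*} [MeasurableSpace α] {ν : Measure α} {p q : ℝ≥0∞}
    [ENNReal.HolderTriple p q 1] {f g : α → V} (hf : MemLp f p ν) (hg : MemLp g q ν) :
    |∫ z, inner ℝ (f z) (g z) ∂ν| ≤ (eLpNorm f p ν).toReal * (eLpNorm g q ν).toReal := by
  have h1 : eLpNorm (fun z => inner ℝ (f z) (g z)) 1 ν ≤ eLpNorm f p ν * eLpNorm g q ν := by
    have := eLpNorm_le_eLpNorm_mul_eLpNorm_of_nnnorm (p := p) (q := q) (r := 1) hf.1 hg.1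
      (fun a b => (inner ℝ a b : ℝ)) 1
      (.of_forall fun z => by simpa using nnnorm_inner_le_nnnorm (𝕜 := ℝ) (f z) (g z))
    simpa using this
  rw [← ENNReal.toReal_mul, ← Real.norm_eq_abs]
  refine (norm_integral_le_lintegral_norm _).trans ?_
  refine ENNReal.toReal_mono (ENNReal.mul_ne_top hf.2.ne hg.2.ne) ?_
  rw [eLpNorm_one_eq_lintegral_enorm] at h1
  simpa only [ofReal_norm] using h1

/-- The pairing of translates of `f ∈ Lᵖ` and `g ∈ L^q`, for conjugate exponents with `p < ∞`, is
continuous at zero in both translations. Translations need not be continuous on `L^q` (here `q = ∞`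
is allowed): the translation of `g` is moved to the other factor. -/
theorem tendsto_setIntegral_inner_translate {p q : ℝ≥0∞} [ENNReal.HolderTriple p q 1]
    (hp1 : 1 ≤ p) (hp : p ≠ ⊤) {f g : Z → V} (hf : MemLp f p μ) (hg : MemLp g q μ)
    {S : Set Z} (hS : MeasurableSet S) :
    Tendsto (fun w : Z × Z => ∫ z in S, inner ℝ (f (z + w.1)) (g (z + w.2)) ∂μ) (𝓝 0)
      (𝓝 (∫ z in S, inner ℝ (f z) (g z) ∂μ)) := by
  have hF : MemLp (S.indicator f) p μ := hf.indicator hS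
  have hft : ∀ w : Z, MemLp (fun z => f (z + w)) p μ := fun w =>
    hf.comp_measurePreserving (measurePreserving_add_right μ w)
  have hFt : ∀ w : Z, MemLp (fun z => S.indicator f (z + w)) p μ := fun w =>
    hF.comp_measurePreserving (measurePreserving_add_right μ w)
  have hgt : ∀ w : Z, MemLp (fun z => g (z + w)) q μ := fun w =>
    hg.comp_measurePreserving (measurePreserving_add_right μ w)
  have hgn : ∀ w : Z, eLpNorm (fun z => g (z + w)) q μ = eLpNorm g q μ := fun w =>
    eLpNorm_comp_measurePreserving hg.1 (measurePreserving_add_right μ w)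
  have key : ∀ w : Z × Z,
      |(∫ z in S, inner ℝ (f (z + w.1)) (g (z + w.2)) ∂μ) - ∫ z in S, inner ℝ (f z) (g z) ∂μ|
        ≤ (eLpNorm (fun z => f (z + w.1) - f z) p μ).toReal * (eLpNorm g q μ).toReal
          + (eLpNorm (fun z => S.indicator f (z + -w.2) - S.indicator f z) p μ).toReal
            * (eLpNorm g q μ).toReal := by
    intro w
    have i1 := (integrable_inner_of_memLp (hft w.1) (hgt w.2)).integrableOn (s := S)
    have i2 := (integrable_inner_of_memLp hf (hgt w.2)).integrableOn (s := S)
    have e1 : ∫ z in S, inner ℝ (f z) (g (z + w.2)) ∂μ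
        = ∫ z, inner ℝ (S.indicator f (z + -w.2)) (g z) ∂μ := by
      rw [← integral_add_right_eq_self (fun z => inner ℝ (S.indicator f (z + -w.2)) (g z)) w.2,
        ← integral_indicator hS]
      refine integral_congr_ae (.of_forall fun z => ?_)
      by_cases hz : z ∈ S <;> simp [hz]
    have e2 : ∫ z in S, inner ℝ (f z) (g z) ∂μ = ∫ z, inner ℝ (S.indicator f z) (g z) ∂μ := by
      rw [← integral_indicator hS]
      refine integral_congr_ae (.of_forall fun z => ?_)
      by_cases hz : z ∈ S <;> simp [hz]
    have e3 : (∫ z in S, inner ℝ (f (z + w.1)) (g (z + w.2)) ∂μ)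
        - ∫ z in S, inner ℝ (f z) (g (z + w.2)) ∂μ
        = ∫ z in S, inner ℝ (f (z + w.1) - f z) (g (z + w.2)) ∂μ := by
      rw [← integral_sub i1 i2]
      simp only [inner_sub_left]
    have e4 : (∫ z in S, inner ℝ (f z) (g (z + w.2)) ∂μ) - ∫ z in S, inner ℝ (f z) (g z) ∂μ
        = ∫ z, inner ℝ (S.indicator f (z + -w.2) - S.indicator f z) (g z) ∂μ := by
      rw [e1, e2, ← integral_sub (integrable_inner_of_memLp (hFt _) hg)
        (integrable_inner_of_memLp hF hg)]
      simp only [inner_sub_left]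
    -- the translation of `f`, then the translation of `g`, moved to `S.indicator f`
    have b1 : |∫ z in S, inner ℝ (f (z + w.1) - f z) (g (z + w.2)) ∂μ|
        ≤ (eLpNorm (fun z => f (z + w.1) - f z) p μ).toReal * (eLpNorm g q μ).toReal := by
      refine (abs_integral_inner_le (p := p) (q := q) (((hft w.1).sub hf).restrict S)
        ((hgt w.2).restrict S)).trans ?_
      rw [← hgn w.2]
      gcongr
      · exact ((hft w.1).sub hf).2.ne
      · exact eLpNorm_mono_measure _ Measure.restrict_le_self
      · exact (hgt w.2).2.ne
      · exact Measure.restrict_le_self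
    have b2 := abs_integral_inner_le (p := p) (q := q) ((hFt (-w.2)).sub hF) hg
    calc _ = |(∫ z in S, inner ℝ (f (z + w.1) - f z) (g (z + w.2)) ∂μ)
          + ∫ z, inner ℝ (S.indicator f (z + -w.2) - S.indicator f z) (g z) ∂μ| := by
            rw [← e3, ← e4]; congr 1; ring
      _ ≤ _ := (abs_add_le _ _).trans (add_le_add b1 b2)
  have t1 : Tendsto (fun w : Z × Z => (eLpNorm (fun z => f (z + w.1) - f z) p μ).toReal)
      (𝓝 0) (𝓝 0) := by
    have := (ENNReal.tendsto_toReal ENNReal.zero_ne_top).comp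
      (tendsto_eLpNorm_translate_sub hp1 hp hf)
    rw [ENNReal.toReal_zero] at this
    exact this.comp (continuous_fst.tendsto (0 : Z × Z))
  have t2 : Tendsto (fun w : Z × Z =>
      (eLpNorm (fun z => S.indicator f (z + -w.2) - S.indicator f z) p μ).toReal)
      (𝓝 0) (𝓝 0) := by
    have := (ENNReal.tendsto_toReal ENNReal.zero_ne_top).comp
      (tendsto_eLpNorm_translate_sub hp1 hp hF)
    have hn : Tendsto (fun w : Z × Z => -w.2) (𝓝 0) (𝓝 0) := by
      have : Continuous (fun w : Z × Z => -w.2) := by fun_prop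
      simpa using this.tendsto 0
    rw [ENNReal.toReal_zero] at this
    exact this.comp hn
  rw [tendsto_iff_norm_sub_tendsto_zero]
  refine squeeze_zero (fun _ => norm_nonneg _) key ?_
  simpa using (t1.mul_const (eLpNorm g q μ).toReal).add (t2.mul_const (eLpNorm g q μ).toReal)

theorem integrable_inner_translate_prod {p q : ℝ≥0∞} [ENNReal.HolderTriple p q 1]
    {f g : Z → V} (hf : MemLp f p μ) (hg : MemLp g q μ) (S : Set Z) (e w : Z) (h : ℝ) :
    Integrable (fun y : ℝ × Z => inner ℝ (f (y.2 + y.1 • e)) (g (y.2 + w)))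
      ((volume.restrict (Ioc 0 h)).prod (μ.restrict S)) := by
  have hmp : MeasurePreserving (fun y : ℝ × Z => (y.1, y.2 + y.1 • e))
      ((volume.restrict (Ioc 0 h)).prod μ) ((volume.restrict (Ioc 0 h)).prod μ) := by
    refine (MeasurePreserving.id _).skew_product (g := fun (s : ℝ) z => z + s • e)
      ?_ (.of_forall fun s => ?_)
    · exact Continuous.measurable (by fun_prop)
    · exact (measurePreserving_add_right μ (s • e)).map_eq
  have h1 : MemLp (fun y : ℝ × Z => f (y.2 + y.1 • e)) p ((volume.restrict (Ioc 0 h)).prod μ) :=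
    (hf.comp_snd (volume.restrict (Ioc 0 h))).comp_measurePreserving hmp
  have h2 : MemLp (fun y : ℝ × Z => g (y.2 + w)) q ((volume.restrict (Ioc 0 h)).prod μ) :=
    (hg.comp_measurePreserving (measurePreserving_add_right μ w)).comp_snd _
  refine (integrable_inner_of_memLp h1 h2).mono_measure ?_
  exact Measure.prod_mono le_rfl Measure.restrict_le_self

/-- The pairing of `f(· + σe)` with `g(· + κhe)`, averaged over `σ ∈ (0,h)`, converges to the
pairing of `f` with `g` as `h → 0`. -/
theorem tendsto_average_inner_translate {p q : ℝ≥0∞} [ENNReal.HolderTriple p q 1]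
    (hp1 : 1 ≤ p) (hp : p ≠ ⊤) {f g : Z → V} (hf : MemLp f p μ) (hg : MemLp g q μ)
    {S : Set Z} (hS : MeasurableSet S) (e : Z) (κ : ℝ) :
    Tendsto (fun h : ℝ => h⁻¹ * ∫ y, inner ℝ (f (y.2 + y.1 • e)) (g (y.2 + (κ * h) • e))
      ∂((volume.restrict (Ioc 0 h)).prod (μ.restrict S))) (𝓝[>] 0)
      (𝓝 (∫ z in S, inner ℝ (f z) (g z) ∂μ)) := by
  set L := ∫ z in S, inner ℝ (f z) (g z) ∂μ with hL
  have ht := tendsto_setIntegral_inner_translate hp1 hp hf hg hS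
  have ht2 : Tendsto (fun y : ℝ × ℝ =>
      ∫ z in S, inner ℝ (f (z + y.1 • e)) (g (z + (κ * y.2) • e)) ∂μ) (𝓝 0) (𝓝 L) := by
    have hc : Tendsto (fun y : ℝ × ℝ => (y.1 • e, (κ * y.2) • e)) (𝓝 0) (𝓝 (0 : Z × Z)) := by
      have : Continuous (fun y : ℝ × ℝ => (y.1 • e, (κ * y.2) • e)) := by fun_prop
      exact this.tendsto' 0 0 (by simp)
    exact ht.comp hc
  rw [Metric.tendsto_nhds] at ht2 ⊢
  intro ε hε
  obtain ⟨δ, hδ, hδ'⟩ := Metric.eventually_nhds_iff.1 (ht2 (ε / 2) (by positivity))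
  filter_upwards [Ioo_mem_nhdsGT hδ] with h hh
  have hI := integrable_inner_translate_prod hf hg S e ((κ * h) • e) h
  rw [integral_prod _ hI]
  have hJ := hI.integral_prod_left
  set φ : ℝ → ℝ := fun s => ∫ z in S, inner ℝ (f (z + s • e)) (g (z + (κ * h) • e)) ∂μ with hφ
  have hb : ∀ s ∈ Ioc 0 h, ‖φ s - L‖ ≤ ε / 2 := by
    intro s hs
    have := hδ' (y := (s, h)) (by
      rw [dist_zero_right, Prod.norm_def]
      simp only [Real.norm_eq_abs, abs_of_pos hs.1, abs_of_pos hh.1]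
      exact max_lt (hs.2.trans_lt hh.2) hh.2)
    exact this.le
  have hd : h⁻¹ * (∫ s in Ioc 0 h, φ s) - L = h⁻¹ * ∫ s in Ioc 0 h, (φ s - L) := by
    rw [integral_sub hJ (integrable_const L)]
    have : (volume.real (Ioc 0 h)) = h := by simp [hh.1.le]
    rw [setIntegral_const, this, smul_eq_mul, mul_sub, ← mul_assoc, inv_mul_cancel₀ hh.1.ne',
      one_mul]
  change dist (h⁻¹ * (∫ s in Ioc 0 h, φ s)) L < ε
  rw [dist_eq_norm, hd, norm_mul, norm_inv, Real.norm_eq_abs h, abs_of_pos hh.1]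
  have hn : ‖∫ s in Ioc 0 h, (φ s - L)‖ ≤ ε / 2 * h := by
    have := norm_setIntegral_le_of_norm_le_const (μ := volume) (s := Ioc 0 h)
      (C := ε / 2) (by simp) hb
    simpa [hh.1.le] using this
  calc h⁻¹ * ‖∫ s in Ioc 0 h, (φ s - L)‖ ≤ h⁻¹ * (ε / 2 * h) := by
        gcongr; exact inv_nonneg.2 hh.1.le
    _ = ε / 2 := by field_simp [hh.1.ne']
    _ < ε := by linarith

end Translation

/-! ### The `L²`-norm as an integral -/

theorem eLpNorm_two_sq {α V : Type*} [MeasurableSpace α] [NormedAddCommGroup V] (ν : Measure α)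
    (f : α → V) : eLpNorm f 2 ν ^ 2 = ∫⁻ x, ‖f x‖ₑ ^ 2 ∂ν := by
  have h := eLpNorm_nnreal_pow_eq_lintegral (f := f) (μ := ν) (p := 2) two_ne_zero
  simpa only [NNReal.coe_ofNat, ENNReal.coe_ofNat, ENNReal.rpow_ofNat] using h

theorem integral_norm_sq_eq {α V : Type*} [MeasurableSpace α] [NormedAddCommGroup V]
    {ν : Measure α} {f : α → V} (hf : MemLp f 2 ν) :
    ∫ x, ‖f x‖ ^ 2 ∂ν = (eLpNorm f 2 ν).toReal ^ 2 := by
  rw [← ENNReal.toReal_pow, eLpNorm_two_sq,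
    integral_eq_lintegral_of_nonneg_ae (.of_forall fun x => by positivity)
      (hf.1.norm.aemeasurable.pow_const 2).aestronglyMeasurable]
  congr 1
  refine lintegral_congr fun x => ?_
  rw [ENNReal.ofReal_pow (norm_nonneg _), ofReal_norm]

/-! ### Weak gradients and the Poincaré inequality -/

theorem HasWeakGrad.ae_eq {n : ℕ} {Ω : Set (Eucl n)} (hΩ : IsOpen Ω) {u : Eucl n → ℝ}
    {G₁ G₂ : Eucl n → Eucl n} (h₁ : HasWeakGrad Ω u G₁) (h₂ : HasWeakGrad Ω u G₂) :
    G₁ =ᵐ[volume.restrict Ω] G₂ := by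
  have hint : ∀ G : Eucl n → Eucl n, LocallyIntegrableOn G Ω → ∀ η : Eucl n → ℝ,
      IsTestFun Ω η → IntegrableOn (fun x => η x • G x) Ω := by
    intro G hG η hη
    have h1 : IntegrableOn (fun x => η x • G x) (tsupport η) :=
      (hG.integrableOn_compact_subset hη.2.2 hη.2.1).continuousOn_smul
        hη.1.continuous.continuousOn hη.2.1
    have h2 : Integrable (fun x => η x • G x) := by
      rwa [integrableOn_iff_integrable_of_support_subset] at h1
      intro x hx
      refine subset_tsupport _ ?_
      intro h0
      simp [h0] at hx
    exact h2.integrableOn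
  have key : ∀ᵐ x ∂(volume : Measure (Eucl n)), x ∈ Ω → (G₁ - G₂) x = 0 := by
    refine hΩ.ae_eq_zero_of_integral_contDiff_smul_eq_zero (h₁.2.1.sub h₂.2.1) ?_
    intro η hη1 hη2 hη3
    have hη : IsTestFun Ω η := ⟨hη1, hη2, hη3⟩
    have hz : ∀ x, x ∉ Ω → η x • (G₁ - G₂) x = 0 := by
      intro x hx
      have : η x = 0 := image_eq_zero_of_notMem_tsupport fun h => hx (hη3 h)
      simp [this]
    rw [← setIntegral_eq_integral_of_forall_compl_eq_zero hz]
    have hi1 := hint G₁ h₁.2.1 η hη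
    have hi2 := hint G₂ h₂.2.1 η hη
    simp only [Pi.sub_apply, smul_sub]
    rw [integral_sub hi1 hi2]
    refine ext_inner_right ℝ fun e => ?_
    have e1 := h₁.2.2 η hη e
    have e2 := h₂.2.2 η hη e
    rw [e1, neg_inj] at e2
    rw [inner_sub_left, inner_zero_left, real_inner_comm e, real_inner_comm e (∫ x in Ω, η x • G₂ x),
      ← integral_inner hi1, ← integral_inner hi2, sub_eq_zero]
    simpa [inner_smul_right, real_inner_comm, mul_comm] using e2
  rw [Filter.EventuallyEq, ae_restrict_iff' hΩ.measurableSet]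
  filter_upwards [key] with x hx hxΩ
  simpa [sub_eq_zero] using hx hxΩ

theorem HasWeakGrad.weakGrad_ae_eq {n : ℕ} {Ω : Set (Eucl n)} (hΩ : IsOpen Ω) {u : Eucl n → ℝ}
    {G : Eucl n → Eucl n} (h : HasWeakGrad Ω u G) :
    weakGrad Ω u =ᵐ[volume.restrict Ω] G := by
  have hex : ∃ G, HasWeakGrad Ω u G := ⟨G, h⟩
  rw [weakGrad, dif_pos hex]
  exact hex.choose_spec.ae_eq hΩ h

theorem IsTestFun.continuous_gradient {n : ℕ} {Ω : Set (Eucl n)} {η : Eucl n → ℝ}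
    (hη : IsTestFun Ω η) : Continuous (gradient η) := by
  have : Continuous (fderiv ℝ η) := hη.1.continuous_fderiv (by simp)
  exact (InnerProductSpace.toDual ℝ (Eucl n)).symm.continuous.comp this

theorem IsTestFun.hasCompactSupport_gradient {n : ℕ} {Ω : Set (Eucl n)} {η : Eucl n → ℝ}
    (hη : IsTestFun Ω η) : HasCompactSupport (gradient η) := by
  have := hη.2.1.fderiv (𝕜 := ℝ)
  exact this.comp_left (g := (InnerProductSpace.toDual ℝ (Eucl n)).symm) (by simp)

/-- The Poincaré inequality for test functions, by integration by parts in
`∫ η² = ∫ η² ∂ᵢ xᵢ = - 2 ∫ xᵢ η ∂ᵢ η`. -/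
theorem IsTestFun.poincare {n : ℕ} (hn : 0 < n) {Ω : Set (Eucl n)} (hΩ : IsOpen Ω) {R : ℝ}
    (hΩR : ∀ x ∈ Ω, ‖x‖ ≤ R) {η : Eucl n → ℝ} (hη : IsTestFun Ω η) :
    (eLpNorm η 2 (volume.restrict Ω)).toReal
      ≤ 2 * R * (eLpNorm (gradient η) 2 (volume.restrict Ω)).toReal := by
  let i : Fin n := ⟨0, hn⟩
  let e : Eucl n := EuclideanSpace.single i 1
  have he : ‖e‖ = 1 := by simp [e]
  let ℓ : Eucl n →L[ℝ] ℝ := innerSL ℝ e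
  have hℓe : ℓ e = 1 := by simp [ℓ, he]
  have hcη := hη.1.continuous
  have hcg := hη.continuous_gradient
  have hηd : Differentiable ℝ η := hη.1.differentiable (by simp)
  have hmη : MemLp η 2 (volume.restrict Ω) := (hcη.memLp_of_hasCompactSupport hη.2.1).restrict Ω
  have hmg : MemLp (gradient η) 2 (volume.restrict Ω) :=
    (hcg.memLp_of_hasCompactSupport hη.hasCompactSupport_gradient).restrict Ω
  have hz : ∀ x, x ∉ Ω → η x = 0 := fun x hx =>
    image_eq_zero_of_notMem_tsupport fun h => hx (hη.2.2 h)
  have hd : ∀ x, fderiv ℝ (fun y => η y ^ 2) x e = 2 * η x * inner ℝ (gradient η x) e := by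
    intro x
    rw [inner_gradient_left, ((hηd x).hasFDerivAt.pow 2).fderiv]
    simp
  have hcs2 : HasCompactSupport (fun y => η y ^ 2) := by
    have := hη.2.1.comp_left (g := fun t : ℝ => t ^ 2) (by simp)
    exact this
  have hℓd : ∀ x, fderiv ℝ (fun y => ℓ y) x e = 1 := fun x => by
    have : fderiv ℝ (fun y => ℓ y) x = ℓ := ℓ.fderiv
    rw [this, hℓe]
  have hparts := integral_mul_fderiv_eq_neg_fderiv_mul_of_integrable (μ := volume)
    (f := fun y => ℓ y) (g := fun y => η y ^ 2) (v := e)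
    (by
      simp only [hℓd, one_mul]
      exact (hcη.pow 2).integrable_of_hasCompactSupport hcs2)
    (by
      refine Continuous.integrable_of_hasCompactSupport ?_ ?_
      · simp only [hd]; fun_prop
      · simp only [hd]
        exact (hη.2.1.mul_left (f := fun x => 2)).mul_right.mul_left)
    (by
      refine Continuous.integrable_of_hasCompactSupport (by fun_prop) hcs2.mul_left)
    (fun x _ => ℓ.differentiableAt) (fun x _ => (hηd x).pow 2)
  simp only [hℓd, one_mul, hd] at hparts
  have h1 : ∫ x in Ω, ‖η x‖ ^ 2 = ∫ x, η x ^ 2 := by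
    simp only [Real.norm_eq_abs, sq_abs]
    exact setIntegral_eq_integral_of_forall_compl_eq_zero fun x hx => by simp [hz x hx]
  have h2 : ∫ x, ℓ x * (2 * η x * inner ℝ (gradient η x) e)
      = ∫ x in Ω, ℓ x * (2 * η x * inner ℝ (gradient η x) e) :=
    (setIntegral_eq_integral_of_forall_compl_eq_zero fun x hx => by simp [hz x hx]).symm
  have hR : Ω.Nonempty → 0 ≤ R := fun ⟨x, hx⟩ => (norm_nonneg x).trans (hΩR x hx)
  rcases Ω.eq_empty_or_nonempty with rfl | hne
  · simp
  have hR := hR hne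
  have h3 : ‖∫ x in Ω, ℓ x * (2 * η x * inner ℝ (gradient η x) e)‖
      ≤ ∫ x in Ω, 2 * R * (‖η x‖ * ‖gradient η x‖) := by
    refine norm_integral_le_of_norm_le ?_ ?_
    · exact ((integrable_inner_of_memLp (p := 2) (q := 2) hmη.norm hmg.norm).const_mul
        (2 * R)).congr (.of_forall fun x => by simp [mul_comm])
    · refine ae_restrict_of_forall_mem hΩ.measurableSet ?_
      intro x hx
      have a1 : ‖ℓ x‖ ≤ R := by
        refine (norm_inner_le_norm e x).trans ?_
        rw [he, one_mul]; exact hΩR x hx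
      have a2 : ‖(inner ℝ (gradient η x) e : ℝ)‖ ≤ ‖gradient η x‖ := by
        simpa [he] using norm_inner_le_norm (𝕜 := ℝ) (gradient η x) e
      rw [norm_mul, norm_mul, norm_mul, Real.norm_two]
      calc ‖ℓ x‖ * (2 * ‖η x‖ * ‖(inner ℝ (gradient η x) e : ℝ)‖)
          ≤ R * (2 * ‖η x‖ * ‖gradient η x‖) := by gcongr
        _ = _ := by ring
  have h4 := abs_integral_inner_le (p := 2) (q := 2) hmη.norm hmg.norm
  have h5 : (∫ x in Ω, ‖η x‖ * ‖gradient η x‖)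
      ≤ (eLpNorm η 2 (volume.restrict Ω)).toReal
        * (eLpNorm (gradient η) 2 (volume.restrict Ω)).toReal := by
    rw [eLpNorm_norm, eLpNorm_norm] at h4
    refine (le_abs_self _).trans (le_of_eq_of_le ?_ h4)
    congr 1
    refine integral_congr_ae (.of_forall fun x => by simp [mul_comm])
  rw [integral_const_mul] at h3
  rw [integral_norm_sq_eq hmη] at h1
  set A := (eLpNorm η 2 (volume.restrict Ω)).toReal
  set B := (eLpNorm (gradient η) 2 (volume.restrict Ω)).toReal
  have hA : 0 ≤ A := ENNReal.toReal_nonneg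
  have hB : 0 ≤ B := ENNReal.toReal_nonneg
  have h6 : A ^ 2 ≤ 2 * R * (A * B) := by
    rw [h1, ← neg_neg (∫ x, η x ^ 2), ← hparts, h2]
    refine (neg_le_abs _).trans (h3.trans ?_)
    gcongr
  rcases hA.eq_or_lt with h0 | h0
  · rw [← h0]; positivity
  · nlinarith

/-- The Poincaré inequality on `H¹₀(Ω)`, by density of test functions. -/
theorem MemH10.poincare {n : ℕ} (hn : 0 < n) {Ω : Set (Eucl n)} (hΩ : IsOpen Ω) {R : ℝ}
    (hR : 0 ≤ R) (hΩR : ∀ x ∈ Ω, ‖x‖ ≤ R) {u : Eucl n → ℝ} (hu : MemH10 Ω u) :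
    eLpNorm u 2 (volume.restrict Ω)
      ≤ ENNReal.ofReal (2 * R) * eLpNorm (weakGrad Ω u) 2 (volume.restrict Ω) := by
  obtain ⟨hu2, G, hG2, hG, η, hη, hη1, hη2⟩ := hu
  rw [eLpNorm_congr_ae (hG.weakGrad_ae_eq hΩ)]
  have hmη : ∀ k, MemLp (η k) 2 (volume.restrict Ω) := fun k =>
    ((hη k).1.continuous.memLp_of_hasCompactSupport (hη k).2.1).restrict Ω
  have hmg : ∀ k, MemLp (gradient (η k)) 2 (volume.restrict Ω) := fun k =>
    ((hη k).continuous_gradient.memLp_of_hasCompactSupport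
      (hη k).hasCompactSupport_gradient).restrict Ω
  have hk : ∀ k, eLpNorm u 2 (volume.restrict Ω)
      ≤ eLpNorm (fun x => u x - η k x) 2 (volume.restrict Ω) + ENNReal.ofReal (2 * R) *
        (eLpNorm (fun x => G x - gradient (η k) x) 2 (volume.restrict Ω)
          + eLpNorm G 2 (volume.restrict Ω)) := by
    intro k
    have b1 : eLpNorm u 2 (volume.restrict Ω)
        ≤ eLpNorm (fun x => u x - η k x) 2 (volume.restrict Ω)
          + eLpNorm (η k) 2 (volume.restrict Ω) := by
      have := eLpNorm_add_le (hu2.1.sub (hmη k).1) (hmη k).1 (p := 2) (by norm_num)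
      rwa [sub_add_cancel] at this
    have b2 : eLpNorm (η k) 2 (volume.restrict Ω)
        ≤ ENNReal.ofReal (2 * R) * eLpNorm (gradient (η k)) 2 (volume.restrict Ω) := by
      rw [← ENNReal.ofReal_toReal (hmη k).2.ne, ← ENNReal.ofReal_toReal (hmg k).2.ne,
        ← ENNReal.ofReal_mul (by positivity)]
      exact ENNReal.ofReal_le_ofReal ((hη k).poincare hn hΩ hΩR)
    have b3 : eLpNorm (gradient (η k)) 2 (volume.restrict Ω)
        ≤ eLpNorm (fun x => G x - gradient (η k) x) 2 (volume.restrict Ω)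
          + eLpNorm G 2 (volume.restrict Ω) := by
      have := eLpNorm_add_le ((hmg k).1.sub hG2.1) hG2.1 (p := 2) (by norm_num)
      have hs := eLpNorm_sub_comm (gradient (η k)) G 2 (volume.restrict Ω)
      rw [hs] at this
      rwa [sub_add_cancel] at this
    refine b1.trans ?_
    gcongr
    exact b2.trans (by gcongr)
  have hl := hη1.add (ENNReal.Tendsto.const_mul (a := ENNReal.ofReal (2 * R))
    (hη2.add_const (eLpNorm G 2 (volume.restrict Ω))) (Or.inr ENNReal.ofReal_ne_top))
  rw [zero_add, zero_add] at hl
  exact ge_of_tendsto' hl hk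

/-! ### The energy identity -/

theorem integral_prod_prod_middle {α β γ : Type*} [MeasurableSpace α] [MeasurableSpace β]
    [MeasurableSpace γ] {A : Measure α} {B : Measure β} {C : Measure γ} [SFinite A] [SFinite B]
    [SFinite C] {H : α × β × γ → ℝ} (hH : Integrable H (A.prod (B.prod C))) :
    Integrable (fun r => ∫ s, ∫ x, H (s, r, x) ∂C ∂A) B ∧
      ∫ y, H y ∂(A.prod (B.prod C)) = ∫ r, ∫ s, ∫ x, H (s, r, x) ∂C ∂A ∂B := by
  have hmp := measurePreserving_prodAssoc A B C
  have h1 : Integrable (fun y : (α × β) × γ => H (y.1.1, y.1.2, y.2)) ((A.prod B).prod C) :=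
    (hmp.integrable_comp hH.1).2 hH
  have h2 := h1.integral_prod_left
  refine ⟨h2.integral_prod_right, ?_⟩
  rw [← hmp.integral_comp' (g := H)]
  change ∫ y : (α × β) × γ, H (y.1.1, y.1.2, y.2) ∂((A.prod B).prod C) = _
  rw [integral_prod _ h1, integral_prod_symm _ h2]

theorem tendsto_average_increment {E : ℝ → ℝ} {s s' β : ℝ} (hE : ContinuousOn E (Icc s s'))
    (hβ : β ∈ Ioo s s') :
    Tendsto (fun h : ℝ => h⁻¹ * ∫ r in Ioo s β, (E (r + h) - E r)) (𝓝[>] 0) (𝓝 (E β - E s)) := by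
  have hss : s ≤ s' := (hβ.1.trans hβ.2).le
  -- extend `E` by constants, so that the fundamental theorem of calculus applies at all points
  set E' : ℝ → ℝ := IccExtend hss ((Icc s s').domRestrict E) with hE'
  have hc : Continuous E' := (continuousOn_iff_continuous_domRestrict.1 hE).Icc_extend'
  have heq : ∀ t ∈ Icc s s', E' t = E t := fun t ht => by
    rw [hE', IccExtend_of_mem _ _ ht]; rfl
  have hP : ∀ t, HasDerivAt (fun t => ∫ r in s..t, E' r) (E' t) t := fun t =>
    intervalIntegral.integral_hasDerivAt_right (hc.intervalIntegrable _ _)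
      hc.stronglyMeasurable.stronglyMeasurableAtFilter hc.continuousAt
  have hΦ : HasDerivAt (fun h : ℝ => (∫ r in s..(β + h), E' r) - ∫ r in s..(s + h), E' r)
      (E' β - E' s) 0 := by
    have h1 : HasDerivAt (fun h : ℝ => ∫ r in s..(β + h), E' r) (E' β) 0 := by
      have := (hP (β + 0)).comp_const_add β 0
      simpa using this
    have h2 : HasDerivAt (fun h : ℝ => ∫ r in s..(s + h), E' r) (E' s) 0 := by
      have := (hP (s + 0)).comp_const_add s 0
      simpa using this
    exact h1.sub h2
  have ht := hΦ.tendsto_slope_zero_right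
  rw [heq β ⟨hβ.1.le, hβ.2.le⟩, heq s ⟨le_rfl, hss⟩] at ht
  refine ht.congr' ?_
  filter_upwards [Ioo_mem_nhdsGT (sub_pos.2 hβ.2)] with h hh
  have hi : ∀ a b, IntervalIntegrable E' volume a b := fun a b => hc.intervalIntegrable a b
  have e1 : ∫ r in Ioo s β, (E (r + h) - E r) = ∫ r in s..β, (E' (r + h) - E' r) := by
    rw [intervalIntegral.integral_of_le hβ.1.le, integral_Ioc_eq_integral_Ioo]
    refine setIntegral_congr_fun measurableSet_Ioo fun r hr => ?_
    have := hh.2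
    have := hh.1
    have := hr.1
    have := hr.2
    have := hβ.2
    rw [heq (r + h) ⟨by linarith, by linarith⟩, heq r ⟨by linarith, by linarith⟩]
  have hs : IntervalIntegrable (fun r => E' (r + h)) volume s β :=
    (hc.comp (continuous_id.add continuous_const)).intervalIntegrable s β
  rw [e1, intervalIntegral.integral_sub hs (hi _ _),
    intervalIntegral.integral_comp_add_right (fun r => E' r), smul_eq_mul, zero_add, add_zero,
    add_zero, intervalIntegral.integral_same]
  have e2 := intervalIntegral.integral_interval_sub_left (hi s (β + h)) (hi s (s + h))
  rw [← e2]
  ring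

section Energy

variable {n : ℕ} {Ω : Set (Eucl n)} {s s' : ℝ} {u f₀ : ℝ → Eucl n → ℝ} {f G : ℝ → Eucl n → Eucl n}

theorem integrable_pairing_density (hu : MemLp (fun p : ℝ × Eucl n => u p.1 p.2) ⊤
      ((volume.restrict (Ioo s s')).prod (volume.restrict Ω)))
    (hG : MemLp (fun p : ℝ × Eucl n => G p.1 p.2) 2
      ((volume.restrict (Ioo s s')).prod (volume.restrict Ω)))
    (hf₀ : Integrable (fun p : ℝ × Eucl n => f₀ p.1 p.2)
      ((volume.restrict (Ioo s s')).prod (volume.restrict Ω)))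
    (hf : MemLp (fun p : ℝ × Eucl n => f p.1 p.2) 2
      ((volume.restrict (Ioo s s')).prod (volume.restrict Ω))) :
    Integrable (fun p : ℝ × Eucl n => f₀ p.1 p.2 * u p.1 p.2 + inner ℝ (f p.1 p.2) (G p.1 p.2))
      ((volume.restrict (Ioo s s')).prod (volume.restrict Ω)) := by
  refine Integrable.add ?_ (integrable_inner_of_memLp hf hG)
  refine (integrable_inner_of_memLp (p := 1) (q := ⊤)
    (memLp_one_iff_integrable.2 hf₀) hu).congr (.of_forall fun p => ?_)
  simp [mul_comm]

theorem pairing_eq (hΩ : IsOpen Ω) {φ₀ w : Eucl n → ℝ} {φ g : Eucl n → Eucl n}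
    (h : HasWeakGrad Ω w g) :
    pairing Ω φ₀ φ w = ∫ x in Ω, (φ₀ x * w x + inner ℝ (φ x) (g x)) := by
  refine integral_congr_ae ?_
  filter_upwards [h.weakGrad_ae_eq hΩ] with x hx
  rw [hx]

/-- The energy identity on a shorter interval. Testing the equation with `u(r)` and with `u(r+h)`
over `(r, r+h)` gives `‖u(r+h)‖² - ‖u(r)‖²`; averaging in `r` makes sense of the limit `h → 0`. -/
theorem energy_identity_of_lt (hΩ : IsOpen Ω)
    (hub : ∀ t ∈ Ioo s s', MemLp (u t) ⊤ (volume.restrict Ω))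
    (hu : MemLp (fun p : ℝ × Eucl n => u p.1 p.2) ⊤
      ((volume.restrict (Ioo s s')).prod (volume.restrict Ω)))
    (hG : MemLp (fun p : ℝ × Eucl n => G p.1 p.2) 2
      ((volume.restrict (Ioo s s')).prod (volume.restrict Ω)))
    (hf₀ : Integrable (fun p : ℝ × Eucl n => f₀ p.1 p.2)
      ((volume.restrict (Ioo s s')).prod (volume.restrict Ω)))
    (hf : MemLp (fun p : ℝ × Eucl n => f p.1 p.2) 2
      ((volume.restrict (Ioo s s')).prod (volume.restrict Ω)))
    (hgrad : ∀ᵐ t ∂(volume.restrict (Ioo s s')), MemH10 Ω (u t) ∧ HasWeakGrad Ω (u t) (G t))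
    (heq : ∀ w : Eucl n → ℝ, MemH10 Ω w → MemLp w ⊤ (volume.restrict Ω) →
      ∀ r t : ℝ, s ≤ r → r ≤ t → t ≤ s' →
        (∫ x in Ω, u t x * w x) - (∫ x in Ω, u r x * w x)
          = ∫ τ in r..t, pairing Ω (f₀ τ) (f τ) w)
    (hE : ContinuousOn (fun t => ∫ x in Ω, u t x * u t x) (Icc s s')) {β : ℝ} (hβ : β ∈ Ioo s s') :
    2 * ∫ r in s..β, (∫ x in Ω, (f₀ r x * u r x + inner ℝ (f r x) (G r x)))
      = (∫ x in Ω, u β x * u β x) - ∫ x in Ω, u s x * u s x := by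
  set D : Set (ℝ × Eucl n) := Ioo s s' ×ˢ Ω with hD
  have hDm : MeasurableSet D := measurableSet_Ioo.prod hΩ.measurableSet
  have hμ : (volume.restrict (Ioo s s')).prod (volume.restrict Ω)
      = (volume.prod volume : Measure (ℝ × Eucl n)).restrict D := by
    rw [Measure.prod_restrict]
  set S : Set (ℝ × Eucl n) := Ioo s β ×ˢ Ω with hS
  have hSm : MeasurableSet S := measurableSet_Ioo.prod hΩ.measurableSet
  have hμS : (volume.restrict (Ioo s β)).prod (volume.restrict Ω)
      = (volume.prod volume : Measure (ℝ × Eucl n)).restrict S := by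
    rw [Measure.prod_restrict]
  have hle : (volume.restrict (Ioo s β)).prod (volume.restrict Ω)
      ≤ (volume.restrict (Ioo s s')).prod (volume.restrict Ω) :=
    Measure.prod_mono (Measure.restrict_mono (Ioo_subset_Ioo_right hβ.2.le) le_rfl) le_rfl
  have hPint := (integrable_pairing_density hu hG hf₀ hf).mono_measure hle
  rw [hμ] at hu hG hf₀ hf
  rw [← memLp_one_iff_integrable] at hf₀
  rw [← memLp_indicator_iff_restrict hDm] at hu hG hf₀ hf
  set U : ℝ × Eucl n → ℝ := D.indicator fun p => u p.1 p.2 with hU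
  set F₀ : ℝ × Eucl n → ℝ := D.indicator fun p => f₀ p.1 p.2 with hF₀
  set Fv : ℝ × Eucl n → Eucl n := D.indicator fun p => f p.1 p.2 with hFv
  set Gv : ℝ × Eucl n → Eucl n := D.indicator fun p => G p.1 p.2 with hGv
  set e : ℝ × Eucl n := (1, 0) with he
  -- the averaged pairings of translates converge
  have hlim : ∀ κ : ℝ, Tendsto (fun h : ℝ => h⁻¹ *
      ∫ y, (inner ℝ (F₀ (y.2 + y.1 • e)) (U (y.2 + (κ * h) • e))
        + inner ℝ (Fv (y.2 + y.1 • e)) (Gv (y.2 + (κ * h) • e)))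
      ∂((volume.restrict (Ioc 0 h)).prod ((volume.restrict (Ioo s β)).prod (volume.restrict Ω))))
      (𝓝[>] 0) (𝓝 (∫ r in s..β, (∫ x in Ω, (f₀ r x * u r x + inner ℝ (f r x) (G r x))))) := by
    intro κ
    have t1 := tendsto_average_inner_translate (p := 1) (q := ⊤) le_rfl (by norm_num) hf₀ hu hSm e κ
    have t2 := tendsto_average_inner_translate (p := 2) (q := 2) (by norm_num) (by norm_num)
      hf hG hSm e κ
    have t := t1.add t2
    have hlimval : (∫ z in S, inner ℝ (F₀ z) (U z) ∂(volume.prod volume))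
        + ∫ z in S, inner ℝ (Fv z) (Gv z) ∂(volume.prod volume)
        = ∫ r in s..β, (∫ x in Ω, (f₀ r x * u r x + inner ℝ (f r x) (G r x))) := by
      rw [intervalIntegral.integral_of_le hβ.1.le, integral_Ioc_eq_integral_Ioo,
        ← integral_prod _ hPint, hμS, ← integral_add
          (integrable_inner_of_memLp (p := 1) (q := ⊤) hf₀ hu).integrableOn
          (integrable_inner_of_memLp (p := 2) (q := 2) hf hG).integrableOn]
      refine setIntegral_congr_fun hSm fun z hz => ?_
      have hzD : z ∈ D := ⟨⟨hz.1.1, hz.1.2.trans hβ.2⟩, hz.2⟩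
      simp [hU, hF₀, hFv, hGv, hzD, mul_comm]
    rw [hlimval] at t
    refine t.congr fun h => ?_
    rw [← mul_add, hμS, ← integral_add
      (integrable_inner_translate_prod (p := 1) (q := ⊤) hf₀ hu S e _ h)
      (integrable_inner_translate_prod (p := 2) (q := 2) hf hG S e _ h)]
  -- their values, from the equation
  have hval : ∀ κ ∈ Icc (0 : ℝ) 1, ∀ h : ℝ, 0 < h → h < s' - β →
      Integrable (fun r => (∫ x in Ω, u (r + h) x * u (r + κ * h) x)
        - ∫ x in Ω, u r x * u (r + κ * h) x) (volume.restrict (Ioo s β)) ∧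
      ∫ y, (inner ℝ (F₀ (y.2 + y.1 • e)) (U (y.2 + (κ * h) • e))
        + inner ℝ (Fv (y.2 + y.1 • e)) (Gv (y.2 + (κ * h) • e)))
      ∂((volume.restrict (Ioc 0 h)).prod ((volume.restrict (Ioo s β)).prod (volume.restrict Ω)))
      = ∫ r in Ioo s β, ((∫ x in Ω, u (r + h) x * u (r + κ * h) x)
        - ∫ x in Ω, u r x * u (r + κ * h) x) := by
    intro κ hκ h hh0 hh
    have hint : Integrable (fun y : ℝ × ℝ × Eucl n =>
        (inner ℝ (F₀ (y.2 + y.1 • e)) (U (y.2 + (κ * h) • e))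
        + inner ℝ (Fv (y.2 + y.1 • e)) (Gv (y.2 + (κ * h) • e)) : ℝ))
        ((volume.restrict (Ioc 0 h)).prod
          ((volume.restrict (Ioo s β)).prod (volume.restrict Ω))) := by
      rw [hμS]
      exact (integrable_inner_translate_prod (p := 1) (q := ⊤) hf₀ hu S e _ h).add
        (integrable_inner_translate_prod (p := 2) (q := 2) hf hG S e _ h)
    obtain ⟨i1, i2⟩ := integral_prod_prod_middle hint
    have hκh0 : 0 ≤ κ * h := mul_nonneg hκ.1 hh0.le
    have hκh1 : κ * h ≤ h := mul_le_of_le_one_left hh0.le hκ.2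
    have hgood : ∀ᵐ r : ℝ, r + κ * h ∈ Ioo s s' →
        MemH10 Ω (u (r + κ * h)) ∧ HasWeakGrad Ω (u (r + κ * h)) (G (r + κ * h)) :=
      (measurePreserving_add_right volume (κ * h)).quasiMeasurePreserving.ae
        ((ae_restrict_iff' measurableSet_Ioo).1 hgrad)
    have hae : (fun r => ∫ σ in Ioc 0 h, ∫ x in Ω,
        (inner ℝ (F₀ ((r, x) + σ • e)) (U ((r, x) + (κ * h) • e))
        + inner ℝ (Fv ((r, x) + σ • e)) (Gv ((r, x) + (κ * h) • e)) : ℝ))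
        =ᵐ[volume.restrict (Ioo s β)] fun r => (∫ x in Ω, u (r + h) x * u (r + κ * h) x)
        - ∫ x in Ω, u r x * u (r + κ * h) x := by
      rw [Filter.EventuallyEq, ae_restrict_iff' measurableSet_Ioo]
      filter_upwards [hgood] with r hr hrI
      have hrI1 := hrI.1
      have hrI2 := hrI.2
      have hmem : r + κ * h ∈ Ioo s s' := ⟨by linarith, by linarith⟩
      obtain ⟨g1, g2⟩ := hr hmem
      rw [heq _ g1 (hub _ hmem) r (r + h) (by linarith) (by linarith) (by linarith)]
      have hshift := intervalIntegral.integral_comp_add_left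
        (fun τ => pairing Ω (f₀ τ) (f τ) (u (r + κ * h))) (a := 0) (b := h) r
      rw [add_zero] at hshift
      rw [← hshift, intervalIntegral.integral_of_le hh0.le]
      refine setIntegral_congr_fun measurableSet_Ioc fun σ hσ => ?_
      rw [pairing_eq hΩ g2]
      refine setIntegral_congr_fun hΩ.measurableSet fun x hx => ?_
      have m1 : (r + σ, x) ∈ D := ⟨⟨by linarith [hσ.1], by linarith [hσ.2]⟩, hx⟩
      have m2 : (r + κ * h, x) ∈ D := ⟨hmem, hx⟩
      simp [he, hU, hF₀, hFv, hGv, m1, m2, mul_comm]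
    exact ⟨i1.congr hae, i2.trans (integral_congr_ae hae)⟩
  have hsum := (hlim 0).add (hlim 1)
  have hincr := tendsto_average_increment hE hβ
  rw [two_mul]
  refine tendsto_nhds_unique hsum (hincr.congr' ?_)
  filter_upwards [Ioo_mem_nhdsGT (sub_pos.2 hβ.2)] with h hh
  obtain ⟨a1, a2⟩ := hval 0 (by simp) h hh.1 hh.2
  obtain ⟨b1, b2⟩ := hval 1 (by simp) h hh.1 hh.2
  rw [a2, b2, ← mul_add, ← integral_add a1 b1]
  congr 1
  refine integral_congr_ae (.of_forall fun r => ?_)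
  simp only [zero_mul, add_zero, one_mul]
  rw [show (∫ x in Ω, u (r + h) x * u r x) = ∫ x in Ω, u r x * u (r + h) x by
    simp only [mul_comm]]
  ring

/-- The energy identity `2 ∫ (∂ₜu, u) dt = ‖u(s')‖² - ‖u(s)‖²` for a bounded
`u ∈ L²(s,s';H¹₀(Ω))`, continuous in norm, with `∂ₜu = f₀ - div f`, `f₀ ∈ L¹` and `f ∈ L²`. -/
theorem energy_identity (hΩ : IsOpen Ω) (hss : s < s')
    (hub : ∀ t ∈ Ioo s s', MemLp (u t) ⊤ (volume.restrict Ω))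
    (hu : MemLp (fun p : ℝ × Eucl n => u p.1 p.2) ⊤
      ((volume.restrict (Ioo s s')).prod (volume.restrict Ω)))
    (hG : MemLp (fun p : ℝ × Eucl n => G p.1 p.2) 2
      ((volume.restrict (Ioo s s')).prod (volume.restrict Ω)))
    (hf₀ : Integrable (fun p : ℝ × Eucl n => f₀ p.1 p.2)
      ((volume.restrict (Ioo s s')).prod (volume.restrict Ω)))
    (hf : MemLp (fun p : ℝ × Eucl n => f p.1 p.2) 2
      ((volume.restrict (Ioo s s')).prod (volume.restrict Ω)))
    (hgrad : ∀ᵐ t ∂(volume.restrict (Ioo s s')), MemH10 Ω (u t) ∧ HasWeakGrad Ω (u t) (G t))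
    (heq : ∀ w : Eucl n → ℝ, MemH10 Ω w → MemLp w ⊤ (volume.restrict Ω) →
      ∀ r t : ℝ, s ≤ r → r ≤ t → t ≤ s' →
        (∫ x in Ω, u t x * w x) - (∫ x in Ω, u r x * w x)
          = ∫ τ in r..t, pairing Ω (f₀ τ) (f τ) w)
    (hE : ContinuousOn (fun t => ∫ x in Ω, u t x * u t x) (Icc s s')) :
    IntervalIntegrable (fun r => pairing Ω (f₀ r) (f r) (u r)) volume s s' ∧
    2 * ∫ r in s..s', pairing Ω (f₀ r) (f r) (u r)
      = (∫ x in Ω, u s' x * u s' x) - ∫ x in Ω, u s x * u s x := by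
  have hQ : Integrable (fun r => ∫ x in Ω, (f₀ r x * u r x + inner ℝ (f r x) (G r x)))
      (volume.restrict (Ioo s s')) :=
    (integrable_pairing_density hu hG hf₀ hf).integral_prod_left
  have hae : (fun r => ∫ x in Ω, (f₀ r x * u r x + inner ℝ (f r x) (G r x)))
      =ᵐ[volume.restrict (Ioo s s')] fun r => pairing Ω (f₀ r) (f r) (u r) := by
    filter_upwards [hgrad] with r hr
    rw [pairing_eq hΩ hr.2]
  have hQI : IntegrableOn (fun r => ∫ x in Ω, (f₀ r x * u r x + inner ℝ (f r x) (G r x)))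
      (Icc s s') := (integrableOn_Icc_iff_integrableOn_Ioo (by simp) (by simp)).2 hQ
  refine ⟨?_, ?_⟩
  · rw [intervalIntegrable_iff_integrableOn_Ioo_of_le hss.le]
    exact hQ.congr hae
  have e1 : ∫ r in s..s', pairing Ω (f₀ r) (f r) (u r)
      = ∫ r in s..s', (∫ x in Ω, (f₀ r x * u r x + inner ℝ (f r x) (G r x))) := by
    rw [intervalIntegral.integral_of_le hss.le, intervalIntegral.integral_of_le hss.le,
      integral_Ioc_eq_integral_Ioo, integral_Ioc_eq_integral_Ioo]
    exact (integral_congr_ae hae).symm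
  rw [e1]
  have hprim := intervalIntegral.continuousOn_primitive_interval (μ := volume) (a := s) (b := s')
    (by rw [uIcc_of_le hss.le]; exact hQI)
  rw [uIcc_of_le hss.le] at hprim
  have hs' : s' ∈ Icc s s' := ⟨hss.le, le_rfl⟩
  have hne : (𝓝[Ioo s s'] s').NeBot := by
    rw [← mem_closure_iff_nhdsWithin_neBot, closure_Ioo hss.ne]
    exact hs'
  have t1 := ((hprim s' hs').mono Ioo_subset_Icc_self).tendsto.const_mul 2
  have t2 := ((hE s' hs').mono Ioo_subset_Icc_self).tendsto.sub_const (∫ x in Ω, u s x * u s x)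
  refine tendsto_nhds_unique t1 (t2.congr' ?_)
  filter_upwards [self_mem_nhdsWithin] with β hβ
  exact (energy_identity_of_lt hΩ hub hu hG hf₀ hf hgrad heq hE hβ).symm

end Energy

/-! ### Coercivity and integrability of the bilinear form -/

theorem lambdaMin_pos_and_coercive {n : ℕ} (hn : 0 < n) {Ω : Set (Eucl n)} (hne : Ω.Nonempty)
    {T : ℝ} (hT : 0 < T) {a : ℝ → Eucl n → Matrix (Fin n) (Fin n) ℝ} (ha : IsCoefficient Ω T a) :
    0 < lambdaMin Ω T a ∧ ∀ t ∈ Ioo 0 T, ∀ x ∈ Ω, ∀ l : Eucl n,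
      lambdaMin Ω T a * ‖l‖ ^ 2 ≤ inner ℝ l ((a t x).toEuclideanLin l) := by
  obtain ⟨lam, hlam, hell⟩ := ha.elliptic
  have hbd : ∀ r ∈ {r : ℝ | ∃ t ∈ Ioo 0 T, ∃ x ∈ Ω, ∃ l : Eucl n, ‖l‖ = 1 ∧
      r = inner ℝ l ((a t x).toEuclideanLin l)}, lam ≤ r := by
    rintro r ⟨t, ht, x, hx, l, hl, rfl⟩
    have := hell t (Ioo_subset_Icc_self ht) x hx l
    simpa [hl] using this
  refine ⟨hlam.trans_le ?_, ?_⟩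
  · refine le_csInf ?_ hbd
    obtain ⟨x, hx⟩ := hne
    exact ⟨_, T / 2, ⟨by linarith, by linarith⟩, x, hx, EuclideanSpace.single ⟨0, hn⟩ 1,
      by simp, rfl⟩
  · intro t ht x hx l
    rcases eq_or_ne l 0 with rfl | hl
    · simp
    have hl' : ‖l‖ ≠ 0 := norm_ne_zero_iff.2 hl
    have h1 : lambdaMin Ω T a
        ≤ inner ℝ (‖l‖⁻¹ • l) ((a t x).toEuclideanLin (‖l‖⁻¹ • l)) :=
      csInf_le ⟨lam, hbd⟩ ⟨t, ht, x, hx, _, by simp [norm_smul, hl'], rfl⟩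
    rw [map_smul, inner_smul_left, inner_smul_right] at h1
    simp only [conj_trivial] at h1
    calc lambdaMin Ω T a * ‖l‖ ^ 2
        ≤ (‖l‖⁻¹ * (‖l‖⁻¹ * inner ℝ l ((a t x).toEuclideanLin l))) * ‖l‖ ^ 2 := by gcongr
      _ = _ := by field_simp

theorem integrable_inner_toEuclideanLin {α : Type*} [MeasurableSpace α] {ν : Measure α} {n : ℕ}
    {A : α → Matrix (Fin n) (Fin n) ℝ} (hA : ∀ i j, MemLp (fun p => A p i j) ⊤ ν)
    {G : α → Eucl n} (hG : MemLp G 2 ν) :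
    Integrable (fun p => inner ℝ (G p) ((A p).toEuclideanLin (G p))) ν := by
  have hGi : ∀ i, MemLp (fun p => G p i) 2 ν := fun i =>
    (EuclideanSpace.proj (𝕜 := ℝ) i : Eucl n →L[ℝ] ℝ).comp_memLp' hG
  have h : ∀ i j, Integrable (fun p => A p i j * G p j * G p i) ν := fun i j => by
    have h1 : MemLp (fun p => A p i j * G p j) 2 ν := (hGi j).mul (hA i j)
    exact h1.integrable_mul (hGi i)
  refine (integrable_finsetSum Finset.univ fun i _ =>
    integrable_finsetSum Finset.univ fun j _ => h i j).congr (.of_forall fun p => ?_)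
  simp only [PiLp.inner_apply, Matrix.toLpLin_apply, Matrix.mulVec, dotProduct]
  refine Finset.sum_congr rfl fun i _ => ?_
  simp [Finset.mul_sum, mul_comm]

/-! ### Elements composed with the harmonic coordinates -/

section Element

variable {n : ℕ} {Ω : Set (Eucl n)} {Φ : Eucl n → ℝ}

theorem IsElement.continuous (h : IsElement Ω Φ) : Continuous Φ := by
  obtain ⟨K, hK⟩ := h.2.1
  exact hK.continuous

theorem IsElement.exists_bound (hΩb : Bornology.IsBounded Ω) (h : IsElement Ω Φ) :
    ∃ B : ℝ, ∀ y, ‖Φ y‖ ≤ B := by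
  obtain ⟨R, hR⟩ := hΩb.subset_closedBall 0
  refine h.continuous.bounded_above_of_compact_support ?_
  exact HasCompactSupport.intro (isCompact_closedBall 0 R) fun x hx => h.2.2 x fun hx' => hx (hR hx')

theorem IsElement.comp_memLp_top (hΩb : Bornology.IsBounded Ω) (h : IsElement Ω Φ)
    {f : Eucl n → Eucl n} (hf : AEStronglyMeasurable f (volume.restrict Ω)) :
    MemLp (fun x => Φ (f x)) ⊤ (volume.restrict Ω) := by
  obtain ⟨B, hB⟩ := h.exists_bound hΩb
  exact memLp_top_of_bound (h.continuous.comp_aestronglyMeasurable hf) B (.of_forall fun x => hB _)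

theorem IsElement.comp_memLp_two (hΩb : Bornology.IsBounded Ω) (h : IsElement Ω Φ)
    {f : Eucl n → Eucl n} (hf : AEStronglyMeasurable f (volume.restrict Ω)) :
    MemLp (fun x => Φ (f x)) 2 (volume.restrict Ω) := by
  have : IsFiniteMeasure (volume.restrict Ω) := ⟨by simpa using hΩb.measure_lt_top⟩
  exact (h.comp_memLp_top hΩb hf).mono_exponent le_top

/-- A Lipschitz function carries the continuity of `F` in `L²` over to `Φ ∘ F`. -/
theorem IsElement.continuousOn_integral_sq (hΩb : Bornology.IsBounded Ω) (h : IsElement Ω Φ)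
    {T : ℝ} {F : ℝ → Eucl n → Eucl n}
    (hF : ∀ t ∈ Icc 0 T, MemLp (F t) 2 (volume.restrict Ω))
    (hFc : ∀ t ∈ Icc 0 T,
      Tendsto (fun s => eLpNorm (fun x => F s x - F t x) 2 (volume.restrict Ω))
        (𝓝[Icc 0 T] t) (𝓝 0)) :
    ContinuousOn (fun t => ∫ x in Ω, Φ (F t x) * Φ (F t x)) (Icc 0 T) := by
  have : IsFiniteMeasure (volume.restrict Ω) := ⟨by simpa using hΩb.measure_lt_top⟩
  obtain ⟨K, hK⟩ := h.2.1
  obtain ⟨B, hB⟩ := h.exists_bound hΩb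
  have hm : ∀ t ∈ Icc 0 T, MemLp (fun x => Φ (F t x)) 2 (volume.restrict Ω) := fun t ht =>
    h.comp_memLp_two hΩb (hF t ht).1
  intro t ht
  have hconst : MemLp (fun _ : Eucl n => 2 * B) 2 (volume.restrict Ω) := memLp_const _
  have hbound : ∀ s ∈ Icc 0 T,
      |(∫ x in Ω, Φ (F s x) * Φ (F s x)) - ∫ x in Ω, Φ (F t x) * Φ (F t x)|
        ≤ (K * (eLpNorm (fun x => F s x - F t x) 2 (volume.restrict Ω)).toReal)
          * (eLpNorm (fun _ : Eucl n => 2 * B) 2 (volume.restrict Ω)).toReal := by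
    intro s hs
    have e1 : (∫ x in Ω, Φ (F s x) * Φ (F s x)) - ∫ x in Ω, Φ (F t x) * Φ (F t x)
        = ∫ x in Ω, inner ℝ (Φ (F s x) - Φ (F t x)) (Φ (F s x) + Φ (F t x)) := by
      have i1 : Integrable (fun x => Φ (F s x) * Φ (F s x)) (volume.restrict Ω) :=
        (hm s hs).integrable_mul (hm s hs)
      have i2 : Integrable (fun x => Φ (F t x) * Φ (F t x)) (volume.restrict Ω) :=
        (hm t ht).integrable_mul (hm t ht)
      rw [← integral_sub i1 i2]
      refine integral_congr_ae (.of_forall fun x => ?_)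
      simp
      ring
    rw [e1]
    refine (abs_integral_inner_le (p := 2) (q := 2) ((hm s hs).sub (hm t ht))
      ((hm s hs).add (hm t ht))).trans ?_
    have hFs := (hF s hs).sub (hF t ht)
    refine mul_le_mul ?_ ?_ ENNReal.toReal_nonneg (by positivity)
    · have := eLpNorm_le_nnreal_smul_eLpNorm_of_ae_le_mul (c := K)
        (f := fun x => Φ (F s x) - Φ (F t x)) (g := fun x => F s x - F t x)
        (μ := volume.restrict Ω) (.of_forall fun x => by
          rw [← NNReal.coe_le_coe]
          simpa [dist_eq_norm] using hK.dist_le_mul (F s x) (F t x)) 2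
      rw [ENNReal.smul_def, smul_eq_mul] at this
      have h2 := ENNReal.toReal_mono (ENNReal.mul_ne_top ENNReal.coe_ne_top hFs.2.ne) this
      rwa [ENNReal.toReal_mul, ENNReal.coe_toReal] at h2
    · refine ENNReal.toReal_mono hconst.2.ne (eLpNorm_mono fun x => ?_)
      have hB0 : 0 ≤ B := (norm_nonneg _).trans (hB 0)
      refine (norm_add_le _ _).trans ?_
      rw [Real.norm_of_nonneg (by positivity : 0 ≤ 2 * B)]
      linarith [hB (F s x), hB (F t x)]
  rw [ContinuousWithinAt, tendsto_iff_norm_sub_tendsto_zero]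
  have hlim := ((((ENNReal.tendsto_toReal ENNReal.zero_ne_top).comp (hFc t ht)).const_mul
    (K : ℝ)).mul_const (eLpNorm (fun _ : Eucl n => 2 * B) 2 (volume.restrict Ω)).toReal)
  rw [ENNReal.toReal_zero, mul_zero, zero_mul] at hlim
  refine squeeze_zero' (.of_forall fun _ => norm_nonneg _) ?_ hlim
  filter_upwards [self_mem_nhdsWithin] with s hs
  exact hbound s hs

end Element

/-! ### One step of the scheme -/

theorem gridTime_lt {T : ℝ} (hT : 0 < T) {M : ℕ} (hM : 0 < M) (k : ℕ) :
    gridTime T M k < gridTime T M (k + 1) := by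
  have : 0 < T / M := by positivity
  simp only [gridTime]
  push_cast
  linarith

theorem gridTime_nonneg {T : ℝ} (hT : 0 < T) (M k : ℕ) : 0 ≤ gridTime T M k := by
  simp only [gridTime]; positivity

theorem gridTime_self (T : ℝ) {M : ℕ} (hM : 0 < M) : gridTime T M M = T := by
  have : (M : ℝ) ≠ 0 := by positivity
  simp only [gridTime]
  field_simp

theorem gridTime_le {T : ℝ} (hT : 0 < T) {M : ℕ} (hM : 0 < M) {k : ℕ} (hk : k ≤ M) :
    gridTime T M k ≤ T := by
  refine le_of_le_of_eq ?_ (gridTime_self T hM)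
  simp only [gridTime]
  gcongr

/-- The energy inequality for one time step: the scheme is tested with its own solution on the
step, and `2 (v_{k+1}(t_k), v_k(t_k)) ≤ ‖v_{k+1}(t_k)‖² + ‖v_k(t_k)‖²`. -/
theorem energy_step {n N M : ℕ} {Ω : Set (Eucl n)} (hΩ : IsOpen Ω) (hΩb : Bornology.IsBounded Ω)
    {T : ℝ} (hT : 0 < T) (hM : 0 < M) {a : ℝ → Eucl n → Matrix (Fin n) (Fin n) ℝ}
    (ha : IsCoefficient Ω T a) {F : ℝ → Eucl n → Eucl n} (hF : IsHarmonicCoord Ω T a F)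
    {φ : Fin N → Eucl n → ℝ} (hφ : ∀ d : Fin N → ℝ, IsElement Ω fun y => ∑ i, d i * φ i y)
    {g : ℝ → Eucl n → ℝ} (hg : MemLp (fun p : ℝ × Eucl n => g p.1 p.2) 2 (cylMeasure Ω T))
    {c : ℝ → Fin N → ℝ} (hc : SolvesScheme Ω T M a g φ F c) {G : ℝ → Eucl n → Eucl n}
    (hG : MemLp (fun p : ℝ × Eucl n => G p.1 p.2) 2 (cylMeasure Ω T))
    (hgrad : ∀ᵐ t ∂(volume.restrict (Ioo 0 T)),
      MemH10 Ω (comb φ F c t) ∧ HasWeakGrad Ω (comb φ F c t) (G t))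
    {lam : ℝ} (hlam : ∀ t ∈ Ioo 0 T, ∀ x ∈ Ω, ∀ l : Eucl n,
      lam * ‖l‖ ^ 2 ≤ inner ℝ l ((a t x).toEuclideanLin l)) {k : ℕ} (hk : k < M) :
    (∫ x in Ω, comb φ F c (gridTime T M (k + 1)) x ^ 2)
        + 2 * (lam * ∫ t in gridTime T M k..gridTime T M (k + 1), ∫ x in Ω, ‖G t x‖ ^ 2)
      ≤ (∫ x in Ω, comb φ F c (gridTime T M k) x ^ 2)
        + 2 * ∫ t in gridTime T M k..gridTime T M (k + 1), ∫ x in Ω, comb φ F c t x * g t x := by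
  obtain ⟨⟨hv, hcst⟩, -, hscheme⟩ := hc
  set s := gridTime T M k with hs
  set s' := gridTime T M (k + 1) with hs'
  have hss : s < s' := gridTime_lt hT hM k
  have hs0 : 0 ≤ s := gridTime_nonneg hT M k
  have hsT : s' ≤ T := gridTime_le hT hM hk
  set d := c s' with hd
  set ψ := comb φ F (fun _ => d) with hψ
  obtain ⟨f₀, f, hder, hstep⟩ := hscheme d
  have hstep := hstep k hk
  simp only [← hs, ← hs', ← hd, ← hψ] at hstep
  have hsub : Ioo s s' ⊆ Ioo 0 T := Ioo_subset_Ioo hs0 hsT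
  have hvψ : ∀ t ∈ Ioo s s', comb φ F c t = ψ t := by
    intro t ht
    ext x
    simp only [comb, hψ, hcst k hk t ⟨ht.1, ht.2.le⟩, hd, ← hs']
  have hμle : (volume.restrict (Ioo s s')).prod (volume.restrict Ω) ≤ cylMeasure Ω T :=
    Measure.prod_mono (Measure.restrict_mono hsub le_rfl) le_rfl
  have hae : ∀ᵐ t ∂(volume.restrict (Ioo s s')), t ∈ Ioo s s' := ae_restrict_mem measurableSet_Ioo
  have hgrad' : ∀ᵐ t ∂(volume.restrict (Ioo s s')), MemH10 Ω (ψ t) ∧ HasWeakGrad Ω (ψ t) (G t) := by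
    filter_upwards [ae_mono (Measure.restrict_mono hsub le_rfl) hgrad, hae] with t h1 h2
    rwa [hvψ t h2] at h1
  have hmeas : ∀ t ∈ Icc 0 T, AEStronglyMeasurable (F t) (volume.restrict Ω) := fun t ht =>
    (hF.memLp t ht).1
  have hψ2 : ∀ t ∈ Icc 0 T, MemLp (ψ t) 2 (volume.restrict Ω) := fun t ht =>
    (hφ d).comp_memLp_two hΩb (hmeas t ht)
  have hψtop : ∀ t ∈ Icc 0 T, MemLp (ψ t) ⊤ (volume.restrict Ω) := fun t ht =>
    (hφ d).comp_memLp_top hΩb (hmeas t ht)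
  have hvψae : (fun p : ℝ × Eucl n => comb φ F c p.1 p.2)
      =ᵐ[(volume.restrict (Ioo s s')).prod (volume.restrict Ω)]
      fun p : ℝ × Eucl n => ψ p.1 p.2 := by
    rw [Measure.prod_restrict]
    refine ae_restrict_of_forall_mem (measurableSet_Ioo.prod hΩ.measurableSet) fun p hp => ?_
    exact congrFun (hvψ p.1 hp.1) p.2
  have hψ2' : MemLp (fun p : ℝ × Eucl n => ψ p.1 p.2) 2
      ((volume.restrict (Ioo s s')).prod (volume.restrict Ω)) :=
    (memLp_congr_ae hvψae).1 (hv.1.mono_measure hμle)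
  have hψtop' : MemLp (fun p : ℝ × Eucl n => ψ p.1 p.2) ⊤
      ((volume.restrict (Ioo s s')).prod (volume.restrict Ω)) := by
    obtain ⟨B, hB⟩ := (hφ d).exists_bound hΩb
    exact memLp_top_of_bound hψ2'.1 B (.of_forall fun p => hB (F p.1 p.2))
  have hG' := hG.mono_measure hμle
  have hsubI : Icc s s' ⊆ Icc 0 T := Icc_subset_Icc hs0 hsT
  obtain ⟨hpi, hpe⟩ := energy_identity hΩ hss
    (fun t ht => hψtop t (hsubI (Ioo_subset_Icc_self ht))) hψtop' hG'
    (hder.integrable.mono_measure hμle) (hder.memLp.mono_measure hμle) hgrad'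
    (fun w hw hw' r t hr hrt ht => hder.eq w hw hw' r t (hs0.trans hr) hrt (ht.trans hsT))
    (((hφ d).continuousOn_integral_sq hΩb hF.memLp hF.continuous).mono hsubI)
  -- the elliptic term
  have hAint := integrable_inner_toEuclideanLin
    (fun i j => (ha.bounded i j).mono_measure hμle) hG'
  have hGint : Integrable (fun p : ℝ × Eucl n => ‖G p.1 p.2‖ ^ 2)
      ((volume.restrict (Ioo s s')).prod (volume.restrict Ω)) := hG'.integrable_norm_pow two_ne_zero
  have hAae : ∀ᵐ t ∂(volume.restrict (Ioo s s')),
      (∫ x in Ω, inner ℝ (G t x) ((a t x).toEuclideanLin (G t x))) = aForm Ω (a t) (ψ t) (ψ t) := by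
    filter_upwards [hgrad'] with t ht
    refine integral_congr_ae ?_
    filter_upwards [ht.2.weakGrad_ae_eq hΩ] with x hx
    rw [hx]
  have hAI : IntervalIntegrable (fun t => aForm Ω (a t) (ψ t) (ψ t)) volume s s' := by
    rw [intervalIntegrable_iff_integrableOn_Ioo_of_le hss.le]
    exact hAint.integral_prod_left.congr hAae
  have hAge : lam * ∫ t in s..s', ∫ x in Ω, ‖G t x‖ ^ 2
      ≤ ∫ t in s..s', aForm Ω (a t) (ψ t) (ψ t) := by
    rw [← intervalIntegral.integral_const_mul]
    rw [intervalIntegral.integral_of_le hss.le, intervalIntegral.integral_of_le hss.le,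
      integral_Ioc_eq_integral_Ioo, integral_Ioc_eq_integral_Ioo]
    refine integral_mono_ae (hGint.integral_prod_left.const_mul lam)
      (hAint.integral_prod_left.congr hAae) ?_
    filter_upwards [hAae, hAint.prod_right_ae, hGint.prod_right_ae, hae] with t h1 h2 h3 h4
    rw [← h1, ← integral_const_mul]
    refine integral_mono_ae (h3.const_mul lam) h2 ?_
    exact ae_restrict_of_forall_mem hΩ.measurableSet fun x hx => hlam t (hsub h4) x hx _
  -- the right-hand side
  have hbint : Integrable (fun p : ℝ × Eucl n => ψ p.1 p.2 * g p.1 p.2)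
      ((volume.restrict (Ioo s s')).prod (volume.restrict Ω)) :=
    hψ2'.integrable_mul (hg.mono_measure hμle)
  have hbI : IntervalIntegrable (fun t => ∫ x in Ω, ψ t x * g t x) volume s s' := by
    rw [intervalIntegrable_iff_integrableOn_Ioo_of_le hss.le]
    exact hbint.integral_prod_left
  have hbeq : ∫ t in s..s', ∫ x in Ω, comb φ F c t x * g t x
      = ∫ t in s..s', ∫ x in Ω, ψ t x * g t x := by
    rw [intervalIntegral.integral_of_le hss.le, intervalIntegral.integral_of_le hss.le,
      integral_Ioc_eq_integral_Ioo, integral_Ioc_eq_integral_Ioo]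
    refine setIntegral_congr_fun measurableSet_Ioo fun t ht => ?_
    simp only [hvψ t ht]
  rw [intervalIntegral.integral_add (hpi.sub hAI) hbI, intervalIntegral.integral_sub hpi hAI]
    at hstep
  rw [hbeq]
  -- the cross term
  have hsmem : s ∈ Icc 0 T := ⟨hs0, hss.le.trans hsT⟩
  have hvk : MemLp (comb φ F c s) 2 (volume.restrict Ω) :=
    (hφ (c s)).comp_memLp_two hΩb (hmeas s hsmem)
  have hcross : 2 * ∫ x in Ω, ψ s x * comb φ F c s x
      ≤ (∫ x in Ω, ψ s x * ψ s x) + ∫ x in Ω, comb φ F c s x ^ 2 := by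
    have j1 : Integrable (fun x => ψ s x * ψ s x) (volume.restrict Ω) :=
      (hψ2 s hsmem).integrable_mul (hψ2 s hsmem)
    have j2 := hvk.integrable_sq
    have j3 : Integrable (fun x => ψ s x * comb φ F c s x) (volume.restrict Ω) :=
      (hψ2 s hsmem).integrable_mul hvk
    rw [← integral_const_mul, ← integral_add j1 j2]
    refine integral_mono (j3.const_mul 2) (j1.add j2) fun x => ?_
    simp only
    nlinarith [sq_nonneg (ψ s x - comb φ F c s x)]
  have hlast : ∫ x in Ω, comb φ F c s' x ^ 2 = ∫ x in Ω, ψ s' x * ψ s' x := by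
    refine integral_congr_ae (.of_forall fun x => ?_)
    simp only [pow_two]
    rfl
  have hcross' : (∫ x in Ω, ψ s x * comb φ F (fun _ => c s) s x)
    = ∫ x in Ω, ψ s x * comb φ F c s x := rfl
  rw [hlast]
  linarith

/-! ### The stability estimate -/

theorem eLpNorm_two_sq_prod {α β V : Type*} [MeasurableSpace α] [MeasurableSpace β]
    [NormedAddCommGroup V] {μ : Measure α} {ν : Measure β} [SFinite ν] {f : α × β → V}
    (hf : AEStronglyMeasurable f (μ.prod ν)) :
    eLpNorm f 2 (μ.prod ν) ^ 2 = ∫⁻ t, eLpNorm (fun x => f (t, x)) 2 ν ^ 2 ∂μ := by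
  rw [eLpNorm_two_sq, lintegral_prod _ (hf.enorm.pow_const 2)]
  simp only [eLpNorm_two_sq]

/-- The energy inequality up to time `T`: the sum of the inequalities of the time steps. -/
theorem energy_inequality {n N M : ℕ} {Ω : Set (Eucl n)} (hΩ : IsOpen Ω)
    (hΩb : Bornology.IsBounded Ω)
    {T : ℝ} (hT : 0 < T) (hM : 0 < M) {a : ℝ → Eucl n → Matrix (Fin n) (Fin n) ℝ}
    (ha : IsCoefficient Ω T a) {F : ℝ → Eucl n → Eucl n} (hF : IsHarmonicCoord Ω T a F)
    {φ : Fin N → Eucl n → ℝ} (hφ : ∀ d : Fin N → ℝ, IsElement Ω fun y => ∑ i, d i * φ i y)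
    {g : ℝ → Eucl n → ℝ} (hg : MemLp (fun p : ℝ × Eucl n => g p.1 p.2) 2 (cylMeasure Ω T))
    {c : ℝ → Fin N → ℝ} (hc : SolvesScheme Ω T M a g φ F c) {G : ℝ → Eucl n → Eucl n}
    (hG : MemLp (fun p : ℝ × Eucl n => G p.1 p.2) 2 (cylMeasure Ω T))
    (hgrad : ∀ᵐ t ∂(volume.restrict (Ioo 0 T)),
      MemH10 Ω (comb φ F c t) ∧ HasWeakGrad Ω (comb φ F c t) (G t))
    {lam : ℝ} (hlam : ∀ t ∈ Ioo 0 T, ∀ x ∈ Ω, ∀ l : Eucl n,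
      lam * ‖l‖ ^ 2 ≤ inner ℝ l ((a t x).toEuclideanLin l)) :
    (∫ x in Ω, comb φ F c T x ^ 2)
        + 2 * (lam * ∫ p, ‖G p.1 p.2‖ ^ 2 ∂(cylMeasure Ω T))
      ≤ 2 * ∫ p, comb φ F c p.1 p.2 * g p.1 p.2 ∂(cylMeasure Ω T) := by
  have hq : Integrable (fun p : ℝ × Eucl n => ‖G p.1 p.2‖ ^ 2) (cylMeasure Ω T) :=
    hG.integrable_norm_pow two_ne_zero
  have hb : Integrable (fun p : ℝ × Eucl n => comb φ F c p.1 p.2 * g p.1 p.2) (cylMeasure Ω T) :=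
    hc.1.1.1.integrable_mul hg
  have hI : ∀ h : ℝ × Eucl n → ℝ, Integrable h (cylMeasure Ω T) → ∀ k ≤ M, ∀ l ≤ M,
      IntervalIntegrable (fun t => ∫ x in Ω, h (t, x)) volume (gridTime T M k) (gridTime T M l) := by
    intro h hh k hk l hl
    have h0 : IntervalIntegrable (fun t => ∫ x in Ω, h (t, x)) volume 0 T := by
      rw [intervalIntegrable_iff_integrableOn_Ioo_of_le hT.le]
      exact hh.integral_prod_left
    refine h0.mono_set ?_
    rw [uIcc_of_le hT.le]
    exact uIcc_subset_Icc ⟨gridTime_nonneg hT M k, gridTime_le hT hM hk⟩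
      ⟨gridTime_nonneg hT M l, gridTime_le hT hM hl⟩
  have hind : ∀ m ≤ M, (∫ x in Ω, comb φ F c (gridTime T M m) x ^ 2)
        + 2 * (lam * ∫ t in gridTime T M 0..gridTime T M m, ∫ x in Ω, ‖G t x‖ ^ 2)
      ≤ 2 * ∫ t in gridTime T M 0..gridTime T M m, ∫ x in Ω, comb φ F c t x * g t x := by
    intro m
    induction m with
    | zero =>
      intro _
      have h0 : gridTime T M 0 = 0 := by simp [gridTime]
      have : ∫ x in Ω, comb φ F c 0 x ^ 2 = 0 := by
        refine integral_eq_zero_of_ae ?_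
        filter_upwards [hc.2.1] with x hx
        simp [hx]
      rw [h0, this]
      simp
    | succ m ih =>
      intro hm
      have h1 := ih (by omega)
      have h2 := energy_step hΩ hΩb hT hM ha hF hφ hg hc hG hgrad hlam (k := m) (by omega)
      rw [← intervalIntegral.integral_add_adjacent_intervals
          (hI _ hq 0 (by omega) m (by omega)) (hI _ hq m (by omega) (m + 1) hm),
        ← intervalIntegral.integral_add_adjacent_intervals
          (hI _ hb 0 (by omega) m (by omega)) (hI _ hb m (by omega) (m + 1) hm)]
      simp only at h2 ⊢
      linarith
  have h := hind M le_rfl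
  have h0 : gridTime T M 0 = 0 := by simp [gridTime]
  rw [gridTime_self T hM, h0, intervalIntegral.integral_of_le hT.le,
    intervalIntegral.integral_of_le hT.le, integral_Ioc_eq_integral_Ioo,
    integral_Ioc_eq_integral_Ioo] at h
  have e1 : ∫ p, ‖G p.1 p.2‖ ^ 2 ∂(cylMeasure Ω T) = _ := integral_prod _ hq
  have e2 : ∫ p, comb φ F c p.1 p.2 * g p.1 p.2 ∂(cylMeasure Ω T) = _ := integral_prod _ hb
  rw [e1, e2]
  exact h

theorem h1Norm_sq {n : ℕ} (Ω : Set (Eucl n)) (u : Eucl n → ℝ) :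
    h1Norm Ω u ^ 2 = eLpNorm u 2 (volume.restrict Ω) ^ 2
      + eLpNorm (weakGrad Ω u) 2 (volume.restrict Ω) ^ 2 := by
  rw [h1Norm, ← ENNReal.rpow_natCast, ← ENNReal.rpow_mul]
  norm_num

/-- From `E² + 2 λ y² ≤ 2 v γ` and `v ≤ P y`, the bounds of `y` and of `E` by `γ`. -/
theorem bounds_of_energy {lam P E y v γ : ℝ} (hlam : 0 < lam) (hP : 0 ≤ P) (hy : 0 ≤ y)
    (hγ : 0 ≤ γ) (hv : v ≤ P * y) (h : E ^ 2 + 2 * (lam * y ^ 2) ≤ 2 * (v * γ)) :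
    y ≤ P / lam * γ ∧ E ≤ √(2 / lam) * P * γ := by
  have h1 : v * γ ≤ P * y * γ := by gcongr
  have h2 : y ≤ P / lam * γ := by
    rw [div_mul_eq_mul_div, le_div_iff₀ hlam]
    rcases hy.eq_or_lt with h0 | h0
    · rw [← h0]; nlinarith [mul_nonneg hP hγ]
    · nlinarith [sq_nonneg E]
  refine ⟨h2, ?_⟩
  refine (abs_le_of_sq_le_sq' ?_ (by positivity)).2
  have h3 : (√(2 / lam) * P * γ) ^ 2 = 2 * (P * (P / lam * γ) * γ) := by
    rw [mul_pow, mul_pow, Real.sq_sqrt (by positivity)]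
    ring
  rw [h3]
  have : P * y * γ ≤ P * (P / lam * γ) * γ := by gcongr
  nlinarith [mul_nonneg hlam.le (sq_nonneg y)]

theorem theorem1p11 (n : ℕ) (hn : 0 < n) (Ω : Set (Eucl n)) (hΩ : IsOpen Ω)
    (hΩb : Bornology.IsBounded Ω) :
    ∃ C : ℝ → ℝ, ∀ (T : ℝ), 0 < T →
      ∀ a : ℝ → Eucl n → Matrix (Fin n) (Fin n) ℝ, IsCoefficient Ω T a →
      ∀ F : ℝ → Eucl n → Eucl n, IsHarmonicCoord Ω T a F →
      ∀ (X : Submodule ℝ (Eucl n → ℝ)), (∀ u ∈ X, IsElement Ω u) →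
      ∀ (N : ℕ) (φ : Module.Basis (Fin N) ℝ X) (M : ℕ), 0 < M →
      ∀ g : ℝ → Eucl n → ℝ, MemLp (fun p : ℝ × Eucl n => g p.1 p.2) 2 (cylMeasure Ω T) →
      ∀ c : ℝ → Fin N → ℝ, SolvesScheme Ω T M a g (fun i => (φ i : Eucl n → ℝ)) F c →
        eLpNorm (comb (fun i => (φ i : Eucl n → ℝ)) F c T) 2 (volume.restrict Ω)
            + l2H1Norm Ω T (comb (fun i => (φ i : Eucl n → ℝ)) F c)
          ≤ ENNReal.ofReal (C (lambdaMin Ω T a))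
            * eLpNorm (fun p : ℝ × Eucl n => g p.1 p.2) 2 (cylMeasure Ω T) := by
  obtain ⟨R₀, hR₀⟩ := hΩb.subset_closedBall 0
  set R : ℝ := max R₀ 0 with hRdef
  have hR : 0 ≤ R := le_max_right _ _
  have hΩR : ∀ x ∈ Ω, ‖x‖ ≤ R := fun x hx => by
    have := hR₀ hx
    rw [mem_closedBall_zero_iff] at this
    exact this.trans (le_max_left _ _)
  set P : ℝ := 2 * R with hP
  have hP0 : 0 ≤ P := by positivity
  refine ⟨fun lam => √(2 / lam) * P + (P + 1) * (P / lam), ?_⟩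
  intro T hT a ha F hF X hX N b M hM g hg c hc
  -- for empty `Ω`, `lambdaMin` is the infimum of the empty set, but both sides vanish
  rcases Ω.eq_empty_or_nonempty with hemp | hne
  · simp [hemp, l2H1Norm, h1Norm]
  obtain ⟨hlam, hcoer⟩ := lambdaMin_pos_and_coercive hn hne hT ha
  set lam := lambdaMin Ω T a
  set φ : Fin N → Eucl n → ℝ := fun i => (b i : Eucl n → ℝ) with hφdef
  have hφ : ∀ d : Fin N → ℝ, IsElement Ω fun y => ∑ i, d i * φ i y := by
    intro d
    refine hX _ ?_
    have : (fun y => ∑ i, d i * φ i y) = ∑ i, d i • (b i : Eucl n → ℝ) := by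
      ext y
      simp [hφdef]
    rw [this]
    exact X.sum_mem fun i _ => X.smul_mem _ (b i).2
  obtain ⟨hv, G, hG, hgrad⟩ := hc.1.1
  have henergy := energy_inequality hΩ hΩb hT hM ha hF hφ hg hc hG hgrad hcoer
  set v := comb φ F c with hvdef
  have hvT : MemLp (v T) 2 (volume.restrict Ω) :=
    (hφ (c T)).comp_memLp_two hΩb (hF.memLp T ⟨hT.le, le_rfl⟩).1
  -- norms of slices
  have hslice : ∀ᵐ t ∂(volume.restrict (Ioo 0 T)),
      eLpNorm (weakGrad Ω (v t)) 2 (volume.restrict Ω) = eLpNorm (G t) 2 (volume.restrict Ω) ∧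
      eLpNorm (v t) 2 (volume.restrict Ω)
        ≤ ENNReal.ofReal P * eLpNorm (G t) 2 (volume.restrict Ω) := by
    filter_upwards [hgrad] with t ht
    have e := eLpNorm_congr_ae (p := 2) (ht.2.weakGrad_ae_eq hΩ)
    refine ⟨e, ?_⟩
    rw [← e]
    exact ht.1.poincare hn hΩ hR hΩR
  set V := eLpNorm (fun p : ℝ × Eucl n => v p.1 p.2) 2 (cylMeasure Ω T) with hV
  set Y := eLpNorm (fun p : ℝ × Eucl n => G p.1 p.2) 2 (cylMeasure Ω T) with hY
  set Γ := eLpNorm (fun p : ℝ × Eucl n => g p.1 p.2) 2 (cylMeasure Ω T) with hΓ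
  have hV2 : V ^ 2 = ∫⁻ t in Ioo 0 T, eLpNorm (v t) 2 (volume.restrict Ω) ^ 2 :=
    eLpNorm_two_sq_prod hv.1
  have hY2 : Y ^ 2 = ∫⁻ t in Ioo 0 T, eLpNorm (G t) 2 (volume.restrict Ω) ^ 2 :=
    eLpNorm_two_sq_prod hG.1
  have hVY : V ≤ ENNReal.ofReal P * Y := by
    rw [← ENNReal.pow_le_pow_left_iff two_ne_zero, mul_pow, hV2, hY2,
      ← lintegral_const_mul' _ _ (by finiteness)]
    refine lintegral_mono_ae ?_
    filter_upwards [hslice] with t ht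
    rw [← mul_pow]
    gcongr
    exact ht.2
  have hl2 : l2H1Norm Ω T v ≤ V + Y := by
    have e : ∫⁻ t in Ioo 0 T, h1Norm Ω (v t) ^ 2 = V ^ 2 + Y ^ 2 := by
      have hm : AEMeasurable (fun t => eLpNorm (G t) 2 (volume.restrict Ω) ^ 2)
          (volume.restrict (Ioo 0 T)) := by
        simp only [eLpNorm_two_sq]
        exact (hG.1.enorm.pow_const 2).lintegral_prod_right'
      rw [hV2, hY2, ← lintegral_add_right' _ hm]
      refine lintegral_congr_ae ?_
      filter_upwards [hslice] with t ht
      rw [h1Norm_sq, ht.1]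
    rw [l2H1Norm, e, one_div, ENNReal.rpow_inv_le_iff (by norm_num)]
    rw [ENNReal.rpow_ofNat, add_sq]
    gcongr
    exact le_self_add
  have hVf : V ≠ ⊤ := hv.2.ne
  have hYf : Y ≠ ⊤ := hG.2.ne
  have hΓf : Γ ≠ ⊤ := hg.2.ne
  have hVYr : V.toReal ≤ P * Y.toReal := by
    have := ENNReal.toReal_mono (ENNReal.mul_ne_top ENNReal.ofReal_ne_top hYf) hVY
    rwa [ENNReal.toReal_mul, ENNReal.toReal_ofReal hP0] at this
  have hE : ∫ x in Ω, v T x ^ 2 = (eLpNorm (v T) 2 (volume.restrict Ω)).toReal ^ 2 := by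
    rw [← integral_norm_sq_eq hvT]
    simp
  have hvg : ∫ p, v p.1 p.2 * g p.1 p.2 ∂(cylMeasure Ω T) ≤ V.toReal * Γ.toReal := by
    refine (le_abs_self _).trans (le_of_eq_of_le ?_ (abs_integral_inner_le (p := 2) (q := 2) hv hg))
    congr 1
    exact integral_congr_ae (.of_forall fun p => by simp [mul_comm])
  rw [hE, integral_norm_sq_eq hG] at henergy
  obtain ⟨b1, b2⟩ := bounds_of_energy hlam hP0 ENNReal.toReal_nonneg ENNReal.toReal_nonneg hVYr
    (henergy.trans (mul_le_mul_of_nonneg_left hvg zero_le_two))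
  calc eLpNorm (v T) 2 (volume.restrict Ω) + l2H1Norm Ω T v
      ≤ eLpNorm (v T) 2 (volume.restrict Ω) + (V + Y) := by gcongr
    _ = ENNReal.ofReal ((eLpNorm (v T) 2 (volume.restrict Ω)).toReal
          + (V.toReal + Y.toReal)) := by
        rw [ENNReal.ofReal_add (by positivity) (by positivity),
          ENNReal.ofReal_add (by positivity) (by positivity), ENNReal.ofReal_toReal hvT.2.ne,
          ENNReal.ofReal_toReal hVf, ENNReal.ofReal_toReal hYf]
    _ ≤ ENNReal.ofReal ((√(2 / lam) * P + (P + 1) * (P / lam)) * Γ.toReal) := by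
        refine ENNReal.ofReal_le_ofReal ?_
        have : P * Y.toReal ≤ P * (P / lam * Γ.toReal) := by gcongr
        linarith
    _ = ENNReal.ofReal (√(2 / lam) * P + (P + 1) * (P / lam)) * Γ := by
        rw [ENNReal.ofReal_mul (by positivity), ENNReal.ofReal_toReal hΓf]
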